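/- **Conventions.** Fix effective pairings, an effective coding of finite lists of natural numbers, and an effective enumeration $(q_j)_{j\in\mathbb N}$ of the positive rationals. A set of natural numbers is r.e. if it is the set of inputs on which some program halts; that program (its Gödel number) is a finite description of the set. A *computable metric space* is a complete metric space $(X,d)$ with a dense sequence $(s_i)_{i\in\mathbb N}$ of *ideal points* such that the reals $d(s_i,s_j)$ are computable uniformly in $i,j$. Its *ideal balls* are $B_{\langle i,j\rangle}=B(s_i,q_j)$ (open balls). In any metric space with a sequence of ideal points: * a point $x$ is *computable* if $\{n : x\in B_n\}$ is r.e.; a description of $x$ is a program for this set; * for $C\subset X$, a map $T:X\to X$ is *computable on $C$* if there is an r.e. set $E\subset\mathbb N^2$ such that $T^{-1}(B_n)\cap C=\bigcup_{(n,i)\in E}B_i\cap C$ for all $n$; a description of $T$ is a program for such an $E$; * a set $K$ is *recursively compact* if it is compact and there is a program (a description of $K$) that halts on input $\langle i_1,\dots,i_p\rangle$ if and only if $K\subset B_{i_1}\cup\dots\cup B_{i_p}$. $PM(X)$ is the set of Borel probability measures on $X$ with finite first moment (all Borel probability measures if $X$ is bounded), with the distance $$W_1(\mu,\nu)=\sup\Big\{\Big|\int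 f\,d\mu-\int f\,d\nu\Big| : f:X\to\mathbb R \text{ 1-Lipschitz}\Big\};$$ its ideal points are the finite rational convex combinations of Dirac measures at ideal points of $X$, numbered effectively. A measure $\mu$ is *$T$-invariant* if $\mu(T^{-1}(A))=\mu(A)$ for every Borel set $A\subset X$. **Theorem.** Let $X$ be a computable metric space. 1. Let $D\subset X$, let $T:X\to X$ be computable on $X\setminus D$, and let $V\subset PM(X)$ be a recursively compact set with $\mu(D)=0$ for every $\mu\in V$. Then every $T$-invariant measure in $V$ that is isolated in the set of $T$-invariant measures belonging to $V$ (for the $W_1$ topology) is a computable point of $PM(X)$. 2. This is uniform: there is a single algorithm (depending only on the computable metric space $X$) such that, for all $D,T,V$ as in 1, given any description of $T$ on $X\setminus D$, any description of $V$, and (the index of) an ideal ball $B(\sigma,r)$ of $PM(X)$ that isolates an invariant measure $\mu\in V$, in the sense that $\mu\in B(\sigma,r)$ and $\mu$ is the only $T$-invariant measure $\nu\in V$ with $W_1(\nu,\sigma)\le r$, it outputs a description of $\mu$. -/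

import Mathlib

open MeasureTheory
open scoped NNReal ENNReal

/-! Numberings and recursively enumerable sets. -/

/-- An effective (surjective) numbering of the rational numbers. -/
def ratNum (n : ℕ) : ℚ :=
  ((n.unpair.1.unpair.1 : ℚ) - (n.unpair.1.unpair.2 : ℚ)) / ((n.unpair.2 : ℚ) + 1)

/-- An effective (surjective) numbering of the positive rational numbers. -/
def posRat (n : ℕ) : ℚ := ((n.unpair.1 : ℚ) + 1) / ((n.unpair.2 : ℚ) + 1)

/-- The recursively enumerable set with Gödel number (program) `c`: the inputs on which `c` halts. -/
def reSet (c : Nat.Partrec.Code) : Set ℕ := {n | (c.eval n).Dom}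

/-! Computable metric spaces. -/

/-- A computable metric space: a complete metric space with a dense sequence of ideal points whose
mutual distances are computable reals (lower and upper semicomputable), uniformly in the indices. -/
structure ComputableMetricSpace (X : Type*) [MetricSpace X] where
  complete : CompleteSpace X
  /-- the ideal points -/
  pt : ℕ → X
  dense : DenseRange pt
  dist_lower : REPred fun p : ℕ × ℕ × ℕ => (ratNum p.2.2 : ℝ) < dist (pt p.1) (pt p.2.1)
  dist_upper : REPred fun p : ℕ × ℕ × ℕ => dist (pt p.1) (pt p.2.1) < (ratNum p.2.2 : ℝ)

section Notions

variable {X Y : Type*} [MetricSpace X] [MetricSpace Y]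

/-- The `n`-th ideal ball `B(s_i, q_j)`, `n = ⟨i, j⟩`, for the sequence `s` of ideal points. -/
def idealBall (s : ℕ → X) (n : ℕ) : Set X :=
  Metric.ball (s n.unpair.1) (posRat n.unpair.2 : ℝ)

/-- The closed ball with the same center and radius as the `n`-th ideal ball. -/
def idealClosedBall (s : ℕ → X) (n : ℕ) : Set X :=
  Metric.closedBall (s n.unpair.1) (posRat n.unpair.2 : ℝ)

/-- `c` is a description of the point `x`: it enumerates the ideal balls that contain `x`. -/
def DescribesPoint (s : ℕ → X) (c : Nat.Partrec.Code) (x : X) : Prop :=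
  reSet c = {n | x ∈ idealBall s n}

/-- `x` is a computable point: its ideal neighborhood basis is r.e. -/
def IsComputablePoint (s : ℕ → X) (x : X) : Prop :=
  ∃ c, DescribesPoint s c x

/-- `c` is a description of `T` on `C`: `c` enumerates a set `E ⊆ ℕ²` such that
`T⁻¹(B_n) ∩ C = U_n ∩ C`, where `U_n` is the union of the ideal balls `B_i` with `(n, i) ∈ E`. -/
def DescribesMapOn (s : ℕ → X) (t : ℕ → Y) (c : Nat.Partrec.Code) (T : X → Y) (C : Set X) : Prop :=
  ∀ n, T ⁻¹' idealBall t n ∩ C = (⋃ i ∈ {i | Nat.pair n i ∈ reSet c}, idealBall s i) ∩ C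

/-- `T` is computable on `C`. -/
def IsComputableOn (s : ℕ → X) (t : ℕ → Y) (T : X → Y) (C : Set X) : Prop :=
  ∃ c, DescribesMapOn s t c T C

/-- `c` is a description of the compact set `K`: on input `⟨i₁, …, i_p⟩` it halts if and only if
the ideal balls `B_{i₁}, …, B_{i_p}` cover `K`. -/
def DescribesCompact (s : ℕ → X) (c : Nat.Partrec.Code) (K : Set X) : Prop :=
  IsCompact K ∧ ∀ l : List ℕ, Encodable.encode l ∈ reSet c ↔ K ⊆ ⋃ i ∈ l, idealBall s i

/-- `K` is recursively compact. -/
def IsRecursivelyCompact (s : ℕ → X) (K : Set X) : Prop :=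
  ∃ c, DescribesCompact s c K

end Notions

/-! The space of probability measures with the Wasserstein-Kantorovich distance. -/

/-- Borel probability measures with finite first moment. If `X` is bounded these are all the Borel
probability measures, see `PM.ofBounded`; in general they are those on which `W₁` is finite. -/
@[ext]
structure PM (X : Type*) [MetricSpace X] [MeasurableSpace X] where
  measure : Measure X
  isProb : IsProbabilityMeasure measure
  moment : ∀ x : X, Integrable (fun y => dist x y) measure

namespace PM

theorem sum_dirac_univ {Z : Type*} [MeasurableSpace Z] (s : ℕ → Z) (l : List ℕ) :
    (l.map fun i => Measure.dirac (s i)).sum Set.univ = l.length := by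
  induction l with
  | nil => simp
  | cons a l ih => simp [ih, add_comm]

variable {X : Type*} [MetricSpace X] [MeasurableSpace X] [BorelSpace X]

attribute [instance] PM.isProb

/-- On a bounded space every Borel probability measure belongs to `PM X`. -/
def ofBounded [BoundedSpace X] (μ : Measure X) [IsProbabilityMeasure μ] : PM X where
  measure := μ
  isProb := inferInstance
  moment x := by
    refine Integrable.of_bound (C := Metric.diam (Set.univ : Set X))
      (by fun_prop : Continuous fun y => dist x y).aestronglyMeasurable (.of_forall fun y => ?_)
    rw [Real.norm_of_nonneg dist_nonneg]
    exact Metric.dist_le_diam_of_mem (Bornology.isBounded_univ.2 ‹_›) trivial trivial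

/-- `W₁(μ, ν) = sup |∫ f dμ - ∫ f dν|` over the 1-Lipschitz functions `f : X → ℝ`. -/
noncomputable def W1 (μ ν : PM X) : ℝ :=
  ⨆ f : {f : X → ℝ // LipschitzWith 1 f}, |∫ x, f.1 x ∂μ.measure - ∫ x, f.1 x ∂ν.measure|

theorem integrable_lipschitz (μ : PM X) {K : ℝ≥0} {f : X → ℝ} (hf : LipschitzWith K f) :
    Integrable f μ.measure := by
  obtain ⟨a⟩ : Nonempty X := nonempty_of_isProbabilityMeasure μ.measure
  refine Integrable.mono' (((μ.moment a).const_mul (K : ℝ)).add (integrable_const |f a|))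
    hf.continuous.aestronglyMeasurable (.of_forall fun y => ?_)
  have h := hf.dist_le_mul y a
  rw [Real.dist_eq, dist_comm] at h
  have := abs_sub_abs_le_abs_sub (f y) (f a)
  simp only [Real.norm_eq_abs, Pi.add_apply]
  linarith

theorem abs_sub_integral_le (μ : PM X) {f : X → ℝ} (hf : LipschitzWith 1 f) (a : X) :
    |∫ x, f x ∂μ.measure - f a| ≤ ∫ x, dist a x ∂μ.measure := by
  have h1 : ∫ x, f x ∂μ.measure - f a = ∫ x, (f x - f a) ∂μ.measure := by
    rw [integral_sub (μ.integrable_lipschitz hf) (integrable_const _)]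
    simp
  rw [h1]
  refine (abs_integral_le_integral_abs).trans (integral_mono_of_nonneg
    (.of_forall fun _ => abs_nonneg _) (μ.moment a) (.of_forall fun y => ?_))
  have h := hf.dist_le_mul y a
  rw [Real.dist_eq, dist_comm] at h
  simpa using h

theorem bddAbove_W1 (μ ν : PM X) : BddAbove (Set.range
    fun f : {f : X → ℝ // LipschitzWith 1 f} =>
      |∫ x, f.1 x ∂μ.measure - ∫ x, f.1 x ∂ν.measure|) := by
  obtain ⟨a⟩ : Nonempty X := nonempty_of_isProbabilityMeasure μ.measure
  refine ⟨∫ x, dist a x ∂μ.measure + ∫ x, dist a x ∂ν.measure, ?_⟩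
  rintro _ ⟨f, rfl⟩
  have h1 := μ.abs_sub_integral_le f.2 a
  have h2 := ν.abs_sub_integral_le f.2 a
  rw [abs_le] at h1 h2 ⊢
  constructor <;> linarith [h1.1, h1.2, h2.1, h2.2]

theorem le_W1 (μ ν : PM X) {f : X → ℝ} (hf : LipschitzWith 1 f) :
    |∫ x, f x ∂μ.measure - ∫ x, f x ∂ν.measure| ≤ W1 μ ν :=
  le_ciSup (bddAbove_W1 μ ν) ⟨f, hf⟩

theorem eq_of_W1_eq_zero {μ ν : PM X} (h : W1 μ ν = 0) : μ = ν := by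
  have key : ∀ (K : ℝ≥0) (f : X → ℝ), LipschitzWith K f →
      ∫ x, f x ∂μ.measure = ∫ x, f x ∂ν.measure := by
    intro K f hf
    have hc : (0 : ℝ) < (K : ℝ) + 1 := by positivity
    have hg : LipschitzWith 1 (fun x => ((K : ℝ) + 1)⁻¹ * f x) := by
      refine LipschitzWith.of_dist_le_mul fun x y => ?_
      rw [Real.dist_eq, ← mul_sub, abs_mul, abs_of_pos (inv_pos.2 hc), ← Real.dist_eq,
        inv_mul_le_iff₀ hc]
      have := hf.dist_le_mul x y
      have h0 : 0 ≤ dist x y := dist_nonneg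
      simp only [NNReal.coe_one, one_mul]
      linarith
    have h1 := le_W1 μ ν hg
    rw [h, integral_const_mul, integral_const_mul, ← mul_sub] at h1
    have h2 := abs_eq_zero.1 (le_antisymm h1 (abs_nonneg _))
    rcases mul_eq_zero.1 h2 with h3 | h3
    · exact absurd h3 (inv_pos.2 hc).ne'
    · linarith
  apply PM.ext
  refine ext_of_generate_finite _ (BorelSpace.measurable_eq.trans borel_eq_generateFrom_isClosed)
    isPiSystem_isClosed (fun F hF => ?_) (by simp)
  have hδ : ∀ n : ℕ, (0 : ℝ) < 1 / ((n : ℝ) + 1) := fun n => by positivity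
  have hlim := tendsto_one_div_add_atTop_nhds_zero_nat (𝕜 := ℝ)
  have e : ∀ n, ∫⁻ x, (thickenedIndicator (hδ n) F x : ℝ≥0∞) ∂μ.measure
      = ∫⁻ x, (thickenedIndicator (hδ n) F x : ℝ≥0∞) ∂ν.measure := by
    intro n
    have hl := lipschitzWith_thickenedIndicator (hδ n) F
    have hl' : LipschitzWith (1 / ((n : ℝ) + 1)).toNNReal⁻¹
        (fun x => (thickenedIndicator (hδ n) F x : ℝ)) :=
      LipschitzWith.of_dist_le_mul fun x y => hl.dist_le_mul x y
    have := key _ _ hl'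
    have t : ∀ ρ : PM X, ∫⁻ x, (thickenedIndicator (hδ n) F x : ℝ≥0∞) ∂ρ.measure
        = ENNReal.ofReal (∫ x, (thickenedIndicator (hδ n) F x : ℝ) ∂ρ.measure) := by
      intro ρ
      rw [ofReal_integral_eq_lintegral_ofReal (ρ.integrable_lipschitz hl')
        (.of_forall fun _ => NNReal.coe_nonneg _)]
      simp
    rw [t, t, this]
  have a1 := tendsto_lintegral_thickenedIndicator_of_isClosed μ.measure hF hδ hlim
  have a2 := tendsto_lintegral_thickenedIndicator_of_isClosed ν.measure hF hδ hlim
  simp only [e] at a1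
  exact tendsto_nhds_unique a1 a2

/-- `PM X` is a metric space under `W₁`. -/
noncomputable instance : MetricSpace (PM X) where
  dist := W1
  dist_self μ := by simp [W1]
  dist_comm μ ν := by simp only [W1, abs_sub_comm]
  dist_triangle μ ν ρ := by
    have : Nonempty {f : X → ℝ // LipschitzWith 1 f} := ⟨⟨fun _ => 0, .const' 0⟩⟩
    refine ciSup_le fun f => ?_
    exact (abs_sub_le _ (∫ x, f.1 x ∂ν.measure) _).trans
      (add_le_add (le_W1 μ ν f.2) (le_W1 ν ρ f.2))
  eq_of_dist_eq_zero := eq_of_W1_eq_zero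

/-- The average of the Dirac measures at `s i`, for `i` in the nonempty list `a :: l`. Repetitions
count, so these are exactly the finite rational convex combinations of the measures `δ_{s i}`. -/
noncomputable def average (s : ℕ → X) (a : ℕ) (l : List ℕ) : Measure X :=
  ((l.length : ℝ≥0∞) + 1)⁻¹ • ((a :: l).map fun i => Measure.dirac (s i)).sum

theorem sum_dirac_integrable (s : ℕ → X) (l : List ℕ) {f : X → ℝ} (hf : Continuous f) :
    Integrable f (l.map fun i => Measure.dirac (s i)).sum := by
  induction l with
  | nil => simp
  | cons a l ih =>
    simp only [List.map_cons, List.sum_cons]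
    exact (integrable_dirac' hf.stronglyMeasurable enorm_lt_top).add_measure ih

/-- The numbered set of ideal points of `PM X`: the finite rational convex combinations of Dirac
measures at the points `s i`. -/
noncomputable def idealPt (s : ℕ → X) (n : ℕ) : PM X where
  measure := average s n.unpair.1 (Denumerable.ofNat (List ℕ) n.unpair.2)
  isProb := ⟨by
    rw [average, Measure.smul_apply, sum_dirac_univ, List.length_cons, smul_eq_mul, Nat.cast_add,
      Nat.cast_one]
    exact ENNReal.inv_mul_cancel (by simp) (by simp)⟩
  moment x := (sum_dirac_integrable s _ (by fun_prop)).smul_measure (by simp)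

end PM

/-! Invariant measures. -/

section Invariant

variable {X : Type*} [MetricSpace X] [MeasurableSpace X]

/-- `μ` is `T`-invariant: `μ(T⁻¹(A)) = μ(A)` for every Borel set `A`. -/
def IsInvariantMeasure (T : X → X) (μ : PM X) : Prop :=
  ∀ A : Set X, MeasurableSet A → μ.measure (T ⁻¹' A) = μ.measure A

/-- `μ` is an isolated point of the set of `T`-invariant measures in `V`. -/
def IsIsolatedInvariant [BorelSpace X] (T : X → X) (V : Set (PM X)) (μ : PM X) : Prop :=
  ∃ U : Set (PM X), IsOpen U ∧ U ∩ {ν | ν ∈ V ∧ IsInvariantMeasure T ν} = {μ}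

/-- The `n`-th ideal ball of `PM X` isolates `μ`: it contains `μ`, and `μ` is the only `T`-invariant
measure in `V` that lies in the closed ball with the same center and radius. -/
def IsolatingBall [BorelSpace X] (s : ℕ → X) (T : X → X) (V : Set (PM X)) (n : ℕ) (μ : PM X) :
    Prop :=
  μ ∈ idealBall (PM.idealPt s) n ∧
    idealClosedBall (PM.idealPt s) n ∩ {ν | ν ∈ V ∧ IsInvariantMeasure T ν} = {μ}

end Invariant

-- Let the `n`-th ideal ball isolate `μ`. Membership of `μ` in the `m`-th ideal ball is equivalent
-- to a finite covering statement (`mem_idealBall_iff_hasCover`): `V` is covered by finitely many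
-- ideal balls, each being the `m`-th one, or formally exterior to the `n`-th (the centres are
-- further apart than the sum of the radii), or certified to contain no invariant measure that
-- vanishes on `D`. Given such a cover, the ball containing `μ` can only be the `m`-th. Conversely,
-- if `μ` is in the `m`-th ball, every point of `V` lies in a ball of one of the three kinds, and
-- compactness extracts a finite cover. The description of `V` recognizes covers, so it remains to
-- enumerate the last two kinds of balls.
--
-- Exterior balls are enumerable because `W₁` between ideal measures is lower semicomputable
-- (`PM.lt_dist_idealPt_iff`). For non-invariance, regularity yields an open `U` with `μ(U) <
-- μ(T⁻¹U)`. Hence there are disjoint finite unions of balls, `A` inside `U` and `G` covering most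
-- of the complement of `U`, such that `T⁻¹A` and `G` have total mass above 1, which invariance
-- forbids. As `μ(D) = 0`, `T⁻¹A` may be replaced by enumerated balls. Masses of open sets being
-- lower semicontinuous (`PM.measureReal_le_add_dist_div`), the inequality passes to a nearby ideal
-- measure, where it is a count of atoms. `RefutesInvariance` is this certificate; it is sound
-- (`RefutesInvariance.not_isInvariantMeasure`) and complete (`exists_refutesInvariance`).

section Computability

open Encodable

variable {α β γ : Type*} [Primcodable α] [Primcodable β] [Primcodable γ]

theorem ComputablePred.comp_computable {p : β → Prop} {f : α → β} (hp : ComputablePred p)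
    (hf : Computable f) : ComputablePred fun a => p (f a) := by
  obtain ⟨q, hq, rfl⟩ := ComputablePred.computable_iff.1 hp
  exact ComputablePred.computable_iff.2 ⟨_, hq.comp hf, rfl⟩

-- Closure properties of r.e. predicates.

namespace REPred

theorem comp_computable {p : β → Prop} {f : α → β} (hp : REPred p) (hf : Computable f) :
    REPred fun a => p (f a) :=
  Partrec.comp hp hf

/-- An r.e. predicate is the projection of a primitive recursive one, which can be taken monotone
in the witness. -/
theorem exists_primrecRel {p : α → Prop} (hp : REPred p) :
    ∃ q : α → ℕ → Prop, PrimrecRel q ∧ (∀ a, p a ↔ ∃ n, q a n) ∧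
      ∀ a m n, m ≤ n → q a m → q a n := by
  obtain ⟨c, hc⟩ := Nat.Partrec.Code.exists_code.1 hp
  -- The witness bounds the evaluation of a program for `p`, whence monotonicity.
  refine ⟨fun a n => (Nat.Partrec.Code.evaln n c (encode a)).isSome, ?_, fun a => ?_, ?_⟩
  · have h : Primrec fun x : α × ℕ => Nat.Partrec.Code.evaln x.2 c (encode x.1) :=
      Nat.Partrec.Code.primrec_evaln.comp
        ((Primrec.snd.pair (Primrec.const c)).pair (Primrec.encode.comp Primrec.fst))
    exact PrimrecPred.of_eq (Primrec.eq.comp (Primrec.option_isSome.comp h) (Primrec.const true))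
      fun _ => Iff.rfl
  · have h : (Nat.Partrec.Code.eval c (encode a)).Dom ↔ p a := by
      rw [hc]
      simp [Part.assert]
    rw [← h, Part.dom_iff_mem]
    simp only [Option.isSome_iff_exists, Nat.Partrec.Code.evaln_complete]
    exact exists_comm
  · intro a m n hmn h
    obtain ⟨x, hx⟩ := Option.isSome_iff_exists.1 h
    exact Option.isSome_iff_exists.2 ⟨x, Nat.Partrec.Code.evaln_mono hmn hx⟩

theorem of_exists_computable {q : α → ℕ → Prop} (hq : ComputablePred fun x : α × ℕ => q x.1 x.2) :
    REPred fun a => ∃ n, q a n := by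
  obtain ⟨f, hf, hfq⟩ := ComputablePred.computable_iff.1 hq
  have h : Partrec fun a => Nat.rfind fun n => (Part.some (f (a, n)) : Part Bool) :=
    Partrec.rfind (Computable.partrec (hf.comp .id))
  refine (Partrec.dom_re h).of_eq fun a => Nat.rfind_dom.trans ?_
  have : ∀ n, q a n ↔ f (a, n) = true := fun n => by
    have := congrFun hfq (a, n)
    simpa using this
  simp [this]

protected theorem and {p q : α → Prop} (hp : REPred p) (hq : REPred q) :
    REPred fun a => p a ∧ q a := by
  obtain ⟨p', hp', hpe, hpm⟩ := hp.exists_primrecRel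
  obtain ⟨q', hq', hqe, hqm⟩ := hq.exists_primrecRel
  refine (of_exists_computable (q := fun a n => p' a n ∧ q' a n)
    (PrimrecPred.and hp' hq').computablePred).of_eq fun a => ?_
  rw [hpe, hqe]
  constructor
  · rintro ⟨n, h1, h2⟩
    exact ⟨⟨n, h1⟩, n, h2⟩
  · rintro ⟨⟨n, h1⟩, m, h2⟩
    exact ⟨max n m, hpm _ _ _ (le_max_left _ _) h1, hqm _ _ _ (le_max_right _ _) h2⟩

protected theorem or {p q : α → Prop} (hp : REPred p) (hq : REPred q) :
    REPred fun a => p a ∨ q a := by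
  obtain ⟨p', hp', hpe, -⟩ := hp.exists_primrecRel
  obtain ⟨q', hq', hqe, -⟩ := hq.exists_primrecRel
  refine (of_exists_computable (q := fun a n => p' a n ∨ q' a n)
    (PrimrecPred.or hp' hq').computablePred).of_eq fun a => ?_
  rw [hpe, hqe, exists_or]

/-- One natural number codes both a candidate `b` and a stage confirming `p (a, b)`, so a single
unbounded search suffices. -/
theorem exists_snd {p : α × β → Prop} (hp : REPred p) : REPred fun a => ∃ b, p (a, b) := by
  obtain ⟨q, hq, hpq, -⟩ := hp.exists_primrecRel
  classical
  have hd : Primrec fun x : (α × β) × ℕ => decide (q x.1 x.2) := PrimrecPred.decide hq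
  have h : Primrec fun x : α × ℕ => (Option.casesOn (decode (α := β) x.2.unpair.1) false
      fun b => decide (q (x.1, b) x.2.unpair.2) : Bool) :=
    Primrec.option_casesOn
      (Primrec.decode.comp (Primrec.fst.comp (Primrec.unpair.comp Primrec.snd)))
      (Primrec.const false)
      (hd.comp (((Primrec.fst.comp Primrec.fst).pair Primrec.snd).pair
        (Primrec.snd.comp (Primrec.unpair.comp (Primrec.snd.comp Primrec.fst)))))
  refine (of_exists_computable (q := fun a n => (Option.casesOn (decode (α := β) n.unpair.1) false
      fun b => decide (q (a, b) n.unpair.2) : Bool) = true)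
    (PrimrecPred.computablePred (PrimrecPred.of_eq (Primrec.eq.comp h (Primrec.const true))
      fun _ => Iff.rfl))).of_eq fun a => ?_
  constructor
  · rintro ⟨n, hn⟩
    cases hb : decode (α := β) n.unpair.1 with
    | none => simp [hb] at hn
    | some b =>
      simp only [hb, decide_eq_true_eq] at hn
      exact ⟨b, (hpq (a, b)).2 ⟨_, hn⟩⟩
  · rintro ⟨b, hb⟩
    obtain ⟨n, hn⟩ := (hpq (a, b)).1 hb
    exact ⟨Nat.pair (encode b) n, by simp [hn]⟩

/-- R.e. predicates are closed under counting the elements of a computable list. -/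
theorem le_countP {p : α → β → Prop} [∀ a, DecidablePred (p a)]
    (hp : REPred fun x : α × β => p x.1 x.2)
    {l : α → List β} (hl : Computable l) {u : α → ℕ} (hu : Computable u) :
    REPred fun a => u a ≤ (l a).countP (p a ·) := by
  obtain ⟨q, hq, hpq, hqm⟩ := hp.exists_primrecRel
  classical
  let R : β → α × ℕ → Prop := fun b x => q (x.1, b) x.2
  have hR : PrimrecRel R := hq.comp₂
    (Primrec₂.mk ((Primrec.fst.comp Primrec.snd).pair Primrec.fst))
    (Primrec₂.mk (Primrec.snd.comp Primrec.snd))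
  have hf : Primrec₂ fun (l : List β) x => (l.filter fun b => R b x) := hR.listFilter
  have hle : ComputablePred fun x : α × ℕ =>
      u x.1 ≤ ((l x.1).filter fun b => R b (x.1, x.2)).length := by
    have h : PrimrecPred fun y : ℕ × (List β × (α × ℕ)) =>
        y.1 ≤ (y.2.1.filter fun b => R b y.2.2).length :=
      Primrec.nat_le.comp Primrec.fst (Primrec.list_length.comp (hf.comp
        (Primrec.fst.comp Primrec.snd) (Primrec.snd.comp Primrec.snd)))
    exact h.computablePred.comp_computable ((hu.comp Computable.fst).pair
      ((hl.comp Computable.fst).pair Computable.id))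
  refine (of_exists_computable (q := fun a n =>
    u a ≤ ((l a).filter fun b => R b (a, n)).length) hle).of_eq fun a => ?_
  -- By monotonicity, one stage confirms all of the finitely many true instances at once.
  have key : ∀ l : List β, ∃ n, l.countP (p a ·) = (l.filter fun b => R b (a, n)).length := by
    intro l
    simp only [← List.countP_eq_length_filter]
    have : ∃ n, ∀ b ∈ l, p a b → q (a, b) n := by
      induction l with
      | nil => exact ⟨0, by simp⟩
      | cons b l ih =>
        obtain ⟨n, hn⟩ := ih
        by_cases hb : p a b
        · obtain ⟨m, hm⟩ := (hpq (a, b)).1 hb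
          refine ⟨max n m, fun c hc h => ?_⟩
          rcases List.mem_cons.1 hc with rfl | hc
          · exact hqm _ _ _ (le_max_right _ _) hm
          · exact hqm _ _ _ (le_max_left _ _) (hn c hc h)
        · refine ⟨n, fun c hc h => ?_⟩
          rcases List.mem_cons.1 hc with rfl | hc
          · exact absurd h hb
          · exact hn c hc h
    obtain ⟨n, hn⟩ := this
    refine ⟨n, List.countP_congr fun b hb => ?_⟩
    simp only [decide_eq_true_eq]
    exact ⟨hn b hb, fun h => (hpq (a, b)).2 ⟨n, h⟩⟩
  constructor
  · rintro ⟨n, hn⟩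
    refine hn.trans ?_
    rw [← List.countP_eq_length_filter]
    refine List.countP_mono_left fun b _ h => ?_
    simp only [decide_eq_true_eq] at h ⊢
    exact (hpq (a, b)).2 ⟨n, h⟩
  · intro h
    obtain ⟨n, hn⟩ := key (l a)
    exact ⟨n, hn ▸ h⟩

/-- The threshold in `le_countP` is the length of the list; `exists_mem` uses the threshold 1. -/
theorem forall_mem {p : α × β → Prop} (hp : REPred p) {l : α → List β} (hl : Computable l) :
    REPred fun a => ∀ b ∈ l a, p (a, b) := by
  classical
  refine (le_countP (p := fun a b => p (a, b)) hp hl (Primrec.list_length.to_comp.comp hl)).of_eq fun a => ?_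
  rw [List.countP_le_length.ge_iff_eq, List.countP_eq_length]
  simp

theorem exists_mem {p : α × β → Prop} (hp : REPred p) {l : α → List β} (hl : Computable l) :
    REPred fun a => ∃ b ∈ l a, p (a, b) := by
  classical
  refine (le_countP (p := fun a b => p (a, b)) hp hl (Computable.const 1)).of_eq fun a => ?_
  rw [Nat.succ_le_iff, List.countP_pos_iff]
  simp

/-- A code for the sections of an r.e. predicate, computable uniformly in the parameter. -/
theorem exists_computable_code {p : α → ℕ → Prop} (hp : REPred fun x : α × ℕ => p x.1 x.2) :
    ∃ Φ : α → Nat.Partrec.Code, Computable Φ ∧ ∀ a, reSet (Φ a) = {m | p a m} := by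
  obtain ⟨c, hc⟩ := Nat.Partrec.Code.exists_code.1 hp
  refine ⟨fun a => c.curry (encode a),
    (Nat.Partrec.Code.primrec₂_curry.comp (Primrec.const c) Primrec.encode).to_comp, fun a => ?_⟩
  ext m
  rw [reSet, Set.mem_ofPred_eq, Nat.Partrec.Code.eval_curry, hc]
  simp [Part.assert]

end REPred

/-- The universal program: the source of uniformity in the descriptions. -/
theorem rePred_mem_reSet : REPred fun x : Nat.Partrec.Code × ℕ => x.2 ∈ reSet x.1 :=
  Partrec.dom_re Nat.Partrec.Code.eval_part

-- Computable arithmetic of naturals and rationals.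

namespace Computable

theorem natAdd {f g : α → ℕ} (hf : Computable f) (hg : Computable g) :
    Computable fun a => f a + g a :=
  Primrec.nat_add.to_comp.comp hf hg

theorem natMul {f g : α → ℕ} (hf : Computable f) (hg : Computable g) :
    Computable fun a => f a * g a :=
  Primrec.nat_mul.to_comp.comp hf hg

theorem natPair {f g : α → ℕ} (hf : Computable f) (hg : Computable g) :
    Computable fun a => Nat.pair (f a) (g a) :=
  Primrec₂.natPair.to_comp.comp hf hg

theorem unpair_fst {f : α → ℕ} (hf : Computable f) : Computable fun a => (f a).unpair.1 :=
  Computable.fst.comp (Computable.unpair.comp hf)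

theorem unpair_snd {f : α → ℕ} (hf : Computable f) : Computable fun a => (f a).unpair.2 :=
  Computable.snd.comp (Computable.unpair.comp hf)

end Computable

/-- Rational-valued functions presented as quotients of differences of computable functions. -/
def ComputableRat (f : α → ℚ) : Prop :=
  ∃ u v w : α → ℕ, Computable u ∧ Computable v ∧ Computable w ∧
    ∀ a, f a = ((u a : ℚ) - v a) / (w a + 1)

namespace ComputableRat

open Computable

theorem natCast {f : α → ℕ} (hf : Computable f) : ComputableRat fun a => (f a : ℚ) :=
  ⟨f, fun _ => 0, fun _ => 0, hf, .const 0, .const 0, fun a => by simp⟩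

theorem one : ComputableRat fun _ : α => (1 : ℚ) := by
  simpa using natCast (.const 1 : Computable fun _ : α => 1)

theorem inv_succ {f : α → ℕ} (hf : Computable f) : ComputableRat fun a => ((f a : ℚ) + 1)⁻¹ :=
  ⟨fun _ => 1, fun _ => 0, f, .const 1, .const 0, hf, fun a => by simp⟩

theorem add {f g : α → ℚ} : ComputableRat f → ComputableRat g →
    ComputableRat fun a => f a + g a := by
  rintro ⟨u, v, w, hu, hv, hw, h⟩ ⟨u', v', w', hu', hv', hw', h'⟩
  -- The last component is the denominator minus one, and `(w + 1)(w' + 1) - 1 = w w' + w + w'`.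
  refine ⟨fun a => u a * (w' a + 1) + u' a * (w a + 1), fun a => v a * (w' a + 1) + v' a * (w a + 1),
    fun a => w a * w' a + w a + w' a,
    (hu.natMul (hw'.natAdd (.const 1))).natAdd (hu'.natMul (hw.natAdd (.const 1))),
    (hv.natMul (hw'.natAdd (.const 1))).natAdd (hv'.natMul (hw.natAdd (.const 1))),
    ((hw.natMul hw').natAdd hw).natAdd hw', fun a => ?_⟩
  have h1 : (w a : ℚ) + 1 ≠ 0 := by positivity
  have h2 : (w' a : ℚ) + 1 ≠ 0 := by positivity
  have h3 : (w a : ℚ) * w' a + w a + w' a + 1 ≠ 0 := by positivity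
  simp only [h, h']
  push_cast
  field_simp
  ring

theorem neg {f : α → ℚ} : ComputableRat f → ComputableRat fun a => -f a := by
  rintro ⟨u, v, w, hu, hv, hw, h⟩
  exact ⟨v, u, w, hv, hu, hw, fun a => by simp only [h]; ring⟩

theorem sub {f g : α → ℚ} (hf : ComputableRat f) (hg : ComputableRat g) :
    ComputableRat fun a => f a - g a := by
  simpa only [sub_eq_add_neg] using hf.add hg.neg

theorem mul {f g : α → ℚ} : ComputableRat f → ComputableRat g →
    ComputableRat fun a => f a * g a := by
  rintro ⟨u, v, w, hu, hv, hw, h⟩ ⟨u', v', w', hu', hv', hw', h'⟩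
  refine ⟨fun a => u a * u' a + v a * v' a, fun a => u a * v' a + v a * u' a,
    fun a => w a * w' a + w a + w' a,
    (hu.natMul hu').natAdd (hv.natMul hv'), (hu.natMul hv').natAdd (hv.natMul hu'),
    ((hw.natMul hw').natAdd hw).natAdd hw', fun a => ?_⟩
  have h1 : (w a : ℚ) + 1 ≠ 0 := by positivity
  have h2 : (w' a : ℚ) + 1 ≠ 0 := by positivity
  have h3 : (w a : ℚ) * w' a + w a + w' a + 1 ≠ 0 := by positivity
  simp only [h, h']
  push_cast
  field_simp
  ring

theorem posRat_comp {f : α → ℕ} (hf : Computable f) : ComputableRat fun a => posRat (f a) := by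
  have := (natCast (hf.unpair_fst.natAdd (.const 1))).mul (inv_succ hf.unpair_snd)
  simpa [posRat, div_eq_mul_inv] using this

theorem lt {f g : α → ℚ} : ComputableRat f → ComputableRat g →
    ComputablePred fun a => f a < g a := by
  rintro ⟨u, v, w, hu, hv, hw, h⟩ ⟨u', v', w', hu', hv', hw', h'⟩
  have h0 : ComputablePred fun a => u a * (w' a + 1) + v' a * (w a + 1) <
      u' a * (w a + 1) + v a * (w' a + 1) :=
    Primrec.nat_lt.computablePred.comp_computable
      (((hu.natMul (hw'.natAdd (.const 1))).natAdd (hv'.natMul (hw.natAdd (.const 1)))).pair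
        ((hu'.natMul (hw.natAdd (.const 1))).natAdd (hv.natMul (hw'.natAdd (.const 1)))))
  refine h0.of_eq fun a => ?_
  have h1 : (0 : ℚ) < (w a : ℚ) + 1 := by positivity
  have h2 : (0 : ℚ) < (w' a : ℚ) + 1 := by positivity
  rw [h, h', div_lt_div_iff₀ h1 h2, ← Nat.cast_lt (α := ℚ)]
  push_cast
  constructor <;> intro h <;> linarith

end ComputableRat

end Computability

namespace ComputableMetricSpace

variable {X α : Type*} [MetricSpace X] [Primcodable α] (S : ComputableMetricSpace X)

theorem rePred_lt_dist {f : α → ℚ} {g h : α → ℕ} (hf : ComputableRat f) (hg : Computable g)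
    (hh : Computable h) : REPred fun a => (f a : ℝ) < dist (S.pt (g a)) (S.pt (h a)) := by
  obtain ⟨u, v, w, hu, hv, hw, hf⟩ := hf
  refine (S.dist_lower.comp_computable (hg.pair (hh.pair ((hu.natPair hv).natPair hw)))).of_eq
    fun a => ?_
  simp [ratNum, hf]

theorem rePred_dist_lt {f : α → ℚ} {g h : α → ℕ} (hf : ComputableRat f) (hg : Computable g)
    (hh : Computable h) : REPred fun a => dist (S.pt (g a)) (S.pt (h a)) < (f a : ℝ) := by
  obtain ⟨u, v, w, hu, hv, hw, hf⟩ := hf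
  refine (S.dist_upper.comp_computable (hg.pair (hh.pair ((hu.natPair hv).natPair hw)))).of_eq
    fun a => ?_
  simp [ratNum, hf]

end ComputableMetricSpace

/-- The arithmetic mean of `f` along a list. -/
noncomputable def listMean (l : List ℕ) (f : ℕ → ℝ) : ℝ := (l.map f).sum / l.length

/-- The constants `c`, `d` absorb the rescaling, shift and rounding in `PM.lt_dist_idealPt_iff`. -/
theorem listMean_le_affine {l : List ℕ} (hl : l ≠ []) {f g : ℕ → ℝ} {c d : ℝ}
    (h : ∀ i ∈ l, f i ≤ c * g i + d) : listMean l f ≤ c * listMean l g + d := by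
  have hpos : (0 : ℝ) < l.length := by exact_mod_cast List.length_pos_iff.2 hl
  have key : (l.map f).sum ≤ c * (l.map g).sum + d * l.length := by
    clear hl hpos
    induction l with
    | nil => simp
    | cons a l ih =>
      have h1 := ih fun i hi => h i (List.mem_cons_of_mem _ hi)
      have h2 := h a List.mem_cons_self
      simp only [List.map_cons, List.sum_cons, List.length_cons]
      push_cast
      linarith
  unfold listMean
  rw [div_le_iff₀ hpos]
  refine key.trans (le_of_eq ?_)
  field_simp

/-- A function that is almost 1-Lipschitz along a finite list of points is approximated there by a
1-Lipschitz function. -/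
theorem exists_lipschitzWith_near {X : Type*} [MetricSpace X] (s : ℕ → X) {l : List ℕ} (c : ℕ → ℝ)
    (hl : l ≠ []) {ε : ℝ} (h : ∀ i ∈ l, ∀ j ∈ l, c i - c j - ε ≤ dist (s i) (s j)) :
    ∃ f : X → ℝ, LipschitzWith 1 f ∧ ∀ i ∈ l, f (s i) ≤ c i ∧ c i ≤ f (s i) + ε := by
  -- McShane's construction: `f x` is the minimum of `c i + dist x (s i)` over the list. That it is
  -- attained gives the lower bound at the points.
  have key : ∀ l : List ℕ, l ≠ [] → ∃ f : X → ℝ, LipschitzWith 1 f ∧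
      (∀ i ∈ l, f (s i) ≤ c i) ∧ ∀ x, ∃ i ∈ l, f x = c i + dist x (s i) := by
    intro l
    induction l with
    | nil => simp
    | cons a l ih =>
      intro _
      have hd : LipschitzWith 1 fun x => c a + dist x (s a) := by
        refine LipschitzWith.of_dist_le_mul fun x y => ?_
        rw [dist_add_left, NNReal.coe_one, one_mul]
        exact abs_dist_sub_le x y (s a)
      by_cases hl : l = []
      · subst hl
        exact ⟨_, hd, by simp, by simp⟩
      obtain ⟨f, hf, h1, h2⟩ := ih hl
      refine ⟨fun x => min (c a + dist x (s a)) (f x), by simpa using hd.min hf, ?_, fun x => ?_⟩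
      · intro i hi
        rcases List.mem_cons.1 hi with rfl | hi
        · simp
        · exact (min_le_right _ _).trans (h1 i hi)
      · obtain ⟨i, hi, h3⟩ := h2 x
        rcases min_choice (c a + dist x (s a)) (f x) with h4 | h4
        · exact ⟨a, List.mem_cons_self, h4⟩
        · exact ⟨i, List.mem_cons_of_mem _ hi, h4.trans h3⟩
  obtain ⟨f, hf, h1, h2⟩ := key l hl
  refine ⟨f, hf, fun i hi => ⟨h1 i hi, ?_⟩⟩
  obtain ⟨j, hj, h3⟩ := h2 (s i)
  linarith [h i hi j hj]

-- Ideal measures and estimates for the distance `W₁`.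

namespace PM

variable {X : Type*} [MetricSpace X] [MeasurableSpace X] [BorelSpace X]

/-- The indices of the atoms of the `n`-th ideal measure, with repetitions. -/
def atoms (n : ℕ) : List ℕ := n.unpair.1 :: Denumerable.ofNat (List ℕ) n.unpair.2

theorem atoms_ne_nil (n : ℕ) : atoms n ≠ [] := List.cons_ne_nil _ _

theorem exists_atoms_eq (a : ℕ) (l : List ℕ) : ∃ n, atoms n = a :: l :=
  ⟨Nat.pair a (Encodable.encode l), by simp [atoms]⟩

theorem integral_sum_dirac (s : ℕ → X) (l : List ℕ) {f : X → ℝ} (hf : Continuous f) :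
    ∫ x, f x ∂(l.map fun i => Measure.dirac (s i)).sum = (l.map fun i => f (s i)).sum := by
  induction l with
  | nil => simp
  | cons a l ih =>
    simp only [List.map_cons, List.sum_cons]
    rw [integral_add_measure (integrable_dirac' hf.stronglyMeasurable enorm_lt_top)
      (sum_dirac_integrable s l hf), ih, integral_dirac]

theorem integral_idealPt (s : ℕ → X) (n : ℕ) {f : X → ℝ} (hf : Continuous f) :
    ∫ x, f x ∂(idealPt s n).measure = listMean (atoms n) fun i => f (s i) := by
  change ∫ x, f x ∂(average s _ _) = _
  rw [average, integral_smul_measure, integral_sum_dirac s _ hf, listMean, div_eq_inv_mul]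
  simp [atoms, ENNReal.toReal_add]

open Classical in
theorem measureReal_idealPt (s : ℕ → X) (n : ℕ) {A : Set X} (hA : MeasurableSet A) :
    (idealPt s n).measure.real A = (atoms n).countP (s · ∈ A) / (atoms n).length := by
  have key : ∀ l : List ℕ, (l.map fun i => Measure.dirac (s i)).sum A =
      (l.countP (s · ∈ A) : ℕ) := by
    intro l
    induction l with
    | nil => simp
    | cons a l ih =>
      simp only [List.map_cons, List.sum_cons, Measure.add_apply, ih, List.countP_cons,
        Measure.dirac_apply' _ hA]
      by_cases h : s a ∈ A <;> simp [h, add_comm]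
  change (average s _ _).real A = _
  rw [average, measureReal_def, Measure.smul_apply, key, div_eq_inv_mul]
  simp [atoms, ENNReal.toReal_add]

theorem integral_sub_integral_le_dist (μ ν : PM X) {f : X → ℝ} (hf : LipschitzWith 1 f) :
    ∫ x, f x ∂μ.measure - ∫ x, f x ∂ν.measure ≤ dist μ ν :=
  (le_abs_self _).trans (le_W1 μ ν hf)

/-- The absolute value in `W1` can be dropped because `-f` is 1-Lipschitz along with `f`. -/
theorem exists_lt_integral_sub {μ ν : PM X} {q : ℝ} (h : q < dist μ ν) :
    ∃ f : X → ℝ, LipschitzWith 1 f ∧ q < ∫ x, f x ∂μ.measure - ∫ x, f x ∂ν.measure := by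
  have : Nonempty {f : X → ℝ // LipschitzWith 1 f} := ⟨⟨fun _ => 0, .const' 0⟩⟩
  obtain ⟨⟨f, hf⟩, hq⟩ := exists_lt_of_lt_ciSup h
  rcases le_total 0 (∫ x, f x ∂μ.measure - ∫ x, f x ∂ν.measure) with h0 | h0
  · exact ⟨f, hf, by rwa [abs_of_nonneg h0] at hq⟩
  · refine ⟨fun x => -f x, hf.neg, ?_⟩
    rw [abs_of_nonpos h0] at hq
    rw [integral_neg, integral_neg]
    linarith

/-- The Wasserstein distance between ideal measures is approximated from below by finite rational
data: the values of almost 1-Lipschitz functions at the atoms, in units of `1 / (N + 1)`. -/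
theorem lt_dist_idealPt_iff (s : ℕ → X) (q : ℝ) (k n : ℕ) :
    q < dist (idealPt s k) (idealPt s n) ↔ ∃ v : List ℕ, ∃ N : ℕ,
      (∀ i ∈ atoms k ++ atoms n, ∀ j ∈ atoms k ++ atoms n,
        ((v.getD i 0 : ℝ) - v.getD j 0 - 1) * ((N : ℝ) + 1)⁻¹ < dist (s i) (s j)) ∧
      q * (N + 1) + 1 < listMean (atoms k) (fun i => v.getD i 0) -
        listMean (atoms n) (fun i => v.getD i 0) := by
  constructor
  · intro h
    obtain ⟨f, hf, hq⟩ := exists_lt_integral_sub h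
    rw [integral_idealPt s k hf.continuous, integral_idealPt s n hf.continuous] at hq
    -- Two units `1 / (N + 1)` must fit into the gap: one is lost by rounding down, the other pays
    -- for the `+ 1` in the certificate.
    obtain ⟨N, hN⟩ := exists_nat_gt (2 / (listMean (atoms k) (fun i => f (s i)) -
      listMean (atoms n) (fun i => f (s i)) - q))
    rw [div_lt_iff₀ (sub_pos.2 hq)] at hN
    set l := atoms k ++ atoms n with hl
    obtain ⟨K, hK⟩ : ∃ K : ℕ, ∀ i ∈ l, i < K := by
      refine ⟨l.sum + 1, fun i hi => Nat.lt_succ_of_le (List.single_le_sum (by simp) i hi)⟩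
    -- Shifting by `C` makes the values nonnegative, so that naturals can encode them; the shift
    -- cancels in the difference of means.
    obtain ⟨C, hC⟩ : ∃ C : ℝ, ∀ i ∈ l, 0 ≤ f (s i) + C := by
      refine ⟨(l.map fun i => |f (s i)|).sum, fun i hi => ?_⟩
      have h1 : |f (s i)| ≤ (l.map fun i => |f (s i)|).sum :=
        List.single_le_sum (by simp) _ (List.mem_map_of_mem hi)
      linarith [neg_abs_le (f (s i))]
    have hN0 : (0 : ℝ) < (N : ℝ) + 1 := by positivity
    let w : ℕ → ℕ := fun i => ⌊((N : ℝ) + 1) * (f (s i) + C)⌋₊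
    have hw : ∀ i ∈ l, (((List.range K).map w).getD i 0 : ℕ) = w i := by
      intro i hi
      simp [List.getD_eq_getElem?_getD, hK i hi]
    have hle : ∀ i ∈ l, (w i : ℝ) ≤ (N + 1) * (f (s i) + C) := fun i hi =>
      Nat.floor_le (mul_nonneg hN0.le (hC i hi))
    have hlt : ∀ i, ((N : ℝ) + 1) * (f (s i) + C) < w i + 1 := fun i => Nat.lt_floor_add_one _
    refine ⟨(List.range K).map w, N, fun i hi j hj => ?_, ?_⟩
    · rw [hw i hi, hw j hj, ← div_eq_mul_inv, div_lt_iff₀ hN0]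
      have h1 : f (s i) - f (s j) ≤ dist (s i) (s j) := by
        have := hf.dist_le_mul (s i) (s j)
        rw [Real.dist_eq, NNReal.coe_one, one_mul] at this
        exact (le_abs_self _).trans this
      have h2 := mul_le_mul_of_nonneg_left h1 hN0.le
      have h3 := hle i hi
      have h4 := hlt j
      nlinarith
    · have h1 : listMean (atoms n) (fun i => (((List.range K).map w).getD i 0 : ℕ)) ≤
          (N + 1) * listMean (atoms n) (fun i => f (s i)) + (N + 1) * C := by
        refine listMean_le_affine (atoms_ne_nil n) fun i hi => ?_
        have hi' : i ∈ l := List.mem_append_right _ hi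
        rw [hw i hi', ← mul_add]
        exact hle i hi'
      have h2 : listMean (atoms k) (fun i => f (s i)) ≤ ((N : ℝ) + 1)⁻¹ *
          listMean (atoms k) (fun i => (((List.range K).map w).getD i 0 : ℕ)) +
            (((N : ℝ) + 1)⁻¹ - C) := by
        refine listMean_le_affine (atoms_ne_nil k) fun i hi => ?_
        rw [hw i (List.mem_append_left _ hi)]
        have h5 : f (s i) + C ≤ ((N : ℝ) + 1)⁻¹ * (w i + 1) := by
          rw [le_inv_mul_iff₀ hN0]
          exact (hlt i).le
        linarith
      have h3 := mul_le_mul_of_nonneg_left h2 hN0.le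
      rw [mul_add, mul_inv_cancel_left₀ hN0.ne', mul_sub, mul_inv_cancel₀ hN0.ne'] at h3
      nlinarith
  · rintro ⟨v, N, hv, hq⟩
    have hN0 : (0 : ℝ) < (N : ℝ) + 1 := by positivity
    obtain ⟨f, hf, hfv⟩ := exists_lipschitzWith_near s (l := atoms k ++ atoms n)
      (fun i => (v.getD i 0 : ℝ) * ((N : ℝ) + 1)⁻¹) (by simp [atoms_ne_nil])
      (ε := ((N : ℝ) + 1)⁻¹) fun i hi j hj => by
        have := (hv i hi j hj).le
        linarith
    have h0 := integral_sub_integral_le_dist (idealPt s k) (idealPt s n) hf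
    rw [integral_idealPt s k hf.continuous, integral_idealPt s n hf.continuous] at h0
    have h1 : listMean (atoms n) (fun i => f (s i)) ≤ ((N : ℝ) + 1)⁻¹ *
        listMean (atoms n) (fun i => v.getD i 0) + 0 := by
      refine listMean_le_affine (atoms_ne_nil n) fun i hi => ?_
      have := (hfv i (List.mem_append_right _ hi)).1
      linarith
    have h2 : listMean (atoms k) (fun i => v.getD i 0) ≤ (N + 1) *
        listMean (atoms k) (fun i => f (s i)) + 1 := by
      refine listMean_le_affine (atoms_ne_nil k) fun i hi => ?_
      have h5 := (hfv i (List.mem_append_left _ hi)).2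
      have h6 := mul_le_mul_of_nonneg_left h5 hN0.le
      rw [mul_add, mul_inv_cancel₀ hN0.ne', mul_comm (v.getD i 0 : ℝ),
        mul_inv_cancel_left₀ hN0.ne'] at h6
      exact h6
    have h3 := mul_le_mul_of_nonneg_left h1 hN0.le
    rw [mul_add, mul_inv_cancel_left₀ hN0.ne'] at h3
    refine lt_of_lt_of_le ?_ h0
    refine lt_of_mul_lt_mul_right ?_ hN0.le
    linarith

/-- Comparison of the masses of nearby sets for nearby measures. -/
theorem measureReal_le_add_dist_div (μ ν : PM X) {P O : Set X} {δ : ℝ} (hδ : 0 < δ)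
    (hO : MeasurableSet O) (h : ∀ x ∈ P, ∀ y ∉ O, δ ≤ dist x y) :
    μ.measure.real P ≤ ν.measure.real O + dist μ ν / δ := by
  -- The distance to `Oᶜ` capped at `δ`, to which Markov's inequality is applied. `Metric.infDist`
  -- to the empty set is `0`, so `O = univ` needs the constant `δ` instead.
  obtain ⟨g, hg, h0, hP, hgO⟩ : ∃ g : X → ℝ, LipschitzWith 1 g ∧ (∀ x, 0 ≤ g x) ∧
      (∀ x ∈ P, δ ≤ g x) ∧ ∀ x, g x ≤ O.indicator (fun _ => δ) x := by
    rcases Oᶜ.eq_empty_or_nonempty with hO' | hO'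
    · refine ⟨fun _ => δ, .const' δ, fun _ => hδ.le, fun _ _ => le_rfl, fun x => ?_⟩
      rw [Set.compl_empty_iff.1 hO']
      simp
    · refine ⟨fun x => min (Metric.infDist x Oᶜ) δ, (Metric.lipschitz_infDist_pt _).min_const δ,
        fun x => le_min Metric.infDist_nonneg hδ.le, fun x hx => ?_, fun x => ?_⟩
      · exact le_min ((Metric.le_infDist hO').2 fun y hy => h x hx y hy) le_rfl
      · by_cases hx : x ∈ O
        · simp [hx]
        · simp [hx, Metric.infDist_zero_of_mem (show x ∈ Oᶜ from hx)]
  have h1 : δ * μ.measure.real P ≤ ∫ x, g x ∂μ.measure :=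
    (mul_le_mul_of_nonneg_left (measureReal_mono hP) hδ.le).trans
      (mul_meas_ge_le_integral_of_nonneg (.of_forall h0) (μ.integrable_lipschitz hg) δ)
  have h2 : ∫ x, g x ∂ν.measure ≤ ν.measure.real O * δ := by
    refine (integral_mono (ν.integrable_lipschitz hg)
      ((integrable_const δ).indicator hO) hgO).trans_eq ?_
    rw [integral_indicator_const _ hO, smul_eq_mul]
  have h3 := integral_sub_integral_le_dist μ ν hg
  rw [← sub_le_iff_le_add', le_div_iff₀ hδ]
  linarith

end PM

-- Density of the ideal measures.

namespace PM

open Filter Topology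

variable {X : Type*} [MetricSpace X] [MeasurableSpace X] [BorelSpace X]

theorem dist_le_of_forall {μ ν : PM X} {ε : ℝ} (h : ∀ f : X → ℝ, LipschitzWith 1 f →
    |∫ x, f x ∂μ.measure - ∫ x, f x ∂ν.measure| ≤ ε) : dist μ ν ≤ ε := by
  have : Nonempty {f : X → ℝ // LipschitzWith 1 f} := ⟨⟨fun _ => 0, .const' 0⟩⟩
  exact ciSup_le fun f => h f.1 f.2

theorem aestronglyMeasurable_dist_nearestPt (μ : Measure X) (s : ℕ → X) (N : ℕ) :
    AEStronglyMeasurable (fun x => dist x (SimpleFunc.nearestPt s N x)) μ := by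
  have : (fun x => dist x (SimpleFunc.nearestPt s N x)) = fun x =>
      ∑ i ∈ Finset.range (N + 1),
        (SimpleFunc.nearestPtInd s N ⁻¹' {i}).indicator (fun y => dist y (s i)) x := by
    ext x
    rw [Finset.sum_eq_single (SimpleFunc.nearestPtInd s N x)]
    · simp [SimpleFunc.nearestPt]
    · intro i _ hi
      exact Set.indicator_of_notMem (fun h => hi h.symm) _
    · intro h
      exact absurd (Finset.mem_range.2 (Nat.lt_succ_of_le (SimpleFunc.nearestPtInd_le s N x))) h
  rw [this]
  refine Measurable.aestronglyMeasurable (Finset.measurable_fun_sum _ fun i _ => ?_)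
  exact Measurable.indicator (by fun_prop) (SimpleFunc.measurableSet_fiber _ _)

theorem norm_dist_nearestPt_le (s : ℕ → X) (N : ℕ) (x : X) :
    ‖dist x (SimpleFunc.nearestPt s N x)‖ ≤ dist (s 0) x := by
  rw [Real.norm_of_nonneg dist_nonneg, dist_comm]
  have := SimpleFunc.edist_nearestPt_le s x (Nat.zero_le N)
  rw [edist_dist, edist_dist] at this
  exact (ENNReal.ofReal_le_ofReal_iff dist_nonneg).1 this

/-- Moving each `x` to the nearest of `s 0, …, s N` costs at most the integrable `dist (s 0) x`, and
the cost tends to zero pointwise by density. -/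
theorem tendsto_integral_dist_nearestPt (μ : PM X) {s : ℕ → X} (hs : DenseRange s) :
    Tendsto (fun N => ∫ x, dist x (SimpleFunc.nearestPt s N x) ∂μ.measure) atTop (𝓝 0) := by
  rw [← integral_zero X ℝ (μ := μ.measure)]
  refine tendsto_integral_of_dominated_convergence (fun x => dist (s 0) x)
    (fun N => aestronglyMeasurable_dist_nearestPt _ s N) (μ.moment (s 0))
    (fun N => .of_forall fun x => norm_dist_nearestPt_le s N x) (.of_forall fun x => ?_)
  have h := (tendsto_const_nhds (x := x)).dist (SimpleFunc.tendsto_nearestPt (e := s) (hs x))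
  rwa [dist_self] at h

theorem integral_comp_nearestPtInd (μ : PM X) (s : ℕ → X) (N : ℕ) (f : ℕ → ℝ) :
    Integrable (fun x => f (SimpleFunc.nearestPtInd s N x)) μ.measure ∧
    ∫ x, f (SimpleFunc.nearestPtInd s N x) ∂μ.measure = ∑ i ∈ Finset.range (N + 1),
      μ.measure.real (SimpleFunc.nearestPtInd s N ⁻¹' {i}) * f i := by
  have h : (fun x => f (SimpleFunc.nearestPtInd s N x)) = fun x =>
      ∑ i ∈ Finset.range (N + 1),
        (SimpleFunc.nearestPtInd s N ⁻¹' {i}).indicator (fun _ => f i) x := by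
    ext x
    rw [Finset.sum_eq_single (SimpleFunc.nearestPtInd s N x)]
    · simp
    · intro i _ hi
      exact Set.indicator_of_notMem (fun h => hi h.symm) _
    · intro h
      exact absurd (Finset.mem_range.2 (Nat.lt_succ_of_le (SimpleFunc.nearestPtInd_le s N x))) h
  have hi : ∀ i ∈ Finset.range (N + 1), Integrable
      ((SimpleFunc.nearestPtInd s N ⁻¹' {i}).indicator (fun _ => f i)) μ.measure := fun i _ =>
    (integrable_const _).indicator (SimpleFunc.measurableSet_fiber _ _)
  rw [h]
  refine ⟨integrable_finsetSum _ hi, ?_⟩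
  rw [integral_finsetSum _ hi]
  refine Finset.sum_congr rfl fun i _ => ?_
  rw [integral_indicator_const _ (SimpleFunc.measurableSet_fiber _ _), smul_eq_mul]

/-- Weights of total mass at most one are approximated by an ideal measure, the missing mass being
put at `s 0`. -/
theorem exists_listMean_near (w : ℕ → ℝ) (hw : ∀ i, 0 ≤ w i) (N : ℕ)
    (hsum : ∑ i ∈ Finset.range (N + 1), w i = 1) (m : ℕ) :
    ∃ n, ∀ f : ℕ → ℝ, |∑ i ∈ Finset.range (N + 1), w i * f i - listMean (atoms n) f| ≤
      ∑ i ∈ Finset.range (N + 1), 2 / ((m : ℝ) + 1) * |f i - f 0| := by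
  have hm : (0 : ℝ) < (m : ℝ) + 1 := by positivity
  let c : ℕ → ℕ := fun i => ⌊w i * m⌋₊
  have hc : ∑ i ∈ Finset.range (N + 1), c i ≤ m := by
    have : ((∑ i ∈ Finset.range (N + 1), c i : ℕ) : ℝ) ≤ m := by
      push_cast
      calc ∑ i ∈ Finset.range (N + 1), (c i : ℝ) ≤ ∑ i ∈ Finset.range (N + 1), w i * m :=
            Finset.sum_le_sum fun i _ => Nat.floor_le (mul_nonneg (hw i) (Nat.cast_nonneg m))
        _ = m := by rw [← Finset.sum_mul, hsum, one_mul]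
    exact_mod_cast this
  have hsums : ∀ (f : ℕ → ℝ) (K : ℕ), (((List.range K).flatMap fun i =>
      List.replicate (c i) i).map f).sum = ∑ i ∈ Finset.range K, c i * f i := by
    intro f K
    induction K with
    | zero => simp
    | succ K ih => simp [List.range_succ, Finset.sum_range_succ, ← ih]
  have hlen : ∀ K : ℕ, ((List.range K).flatMap fun i => List.replicate (c i) i).length =
      ∑ i ∈ Finset.range K, c i := by
    intro K
    induction K with
    | zero => simp
    | succ K ih => simp [List.range_succ, Finset.sum_range_succ, ← ih]
  -- Each `i` is repeated `c i` times and copies of `0` pad the list to exactly `m + 1` atoms, the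
  -- leading `0` included.
  obtain ⟨n, hn⟩ := exists_atoms_eq 0 (((List.range (N + 1)).flatMap fun i =>
    List.replicate (c i) i) ++ List.replicate (m - ∑ i ∈ Finset.range (N + 1), c i) 0)
  refine ⟨n, fun f => ?_⟩
  have hlen' : ((atoms n).length : ℝ) = m + 1 := by
    rw [hn, List.length_cons, List.length_append, hlen, List.length_replicate,
      Nat.add_sub_cancel' hc]
    push_cast
    rfl
  -- Relative to `f 0` the padding contributes nothing.
  have hmean : listMean (atoms n) f - f 0 =
      ∑ i ∈ Finset.range (N + 1), c i / ((m : ℝ) + 1) * (f i - f 0) := by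
    rw [listMean, hlen', hn, List.map_cons, List.sum_cons, List.map_append, List.sum_append, hsums,
      List.map_replicate, List.sum_replicate, nsmul_eq_mul, Nat.cast_sub hc]
    simp only [mul_sub, Finset.sum_sub_distrib, ← Finset.sum_mul, div_mul_eq_mul_div,
      ← Finset.sum_div]
    push_cast
    field_simp
    ring
  have hw0 : ∑ i ∈ Finset.range (N + 1), w i * f i - f 0 =
      ∑ i ∈ Finset.range (N + 1), w i * (f i - f 0) := by
    simp only [mul_sub, Finset.sum_sub_distrib, ← Finset.sum_mul, hsum, one_mul]
  rw [← sub_sub_sub_cancel_right _ _ (f 0), hmean, hw0, ← Finset.sum_sub_distrib]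
  refine (Finset.abs_sum_le_sum_abs _ _).trans (Finset.sum_le_sum fun i hi => ?_)
  rw [← sub_mul, abs_mul]
  refine mul_le_mul_of_nonneg_right ?_ (abs_nonneg _)
  have hw1 : w i ≤ 1 := hsum ▸ Finset.single_le_sum (fun i _ => hw i) hi
  have h1 : (c i : ℝ) ≤ w i * m := Nat.floor_le (mul_nonneg (hw i) (Nat.cast_nonneg m))
  have h2 : w i * m < c i + 1 := Nat.lt_floor_add_one _
  -- Rounding and the change of denominator from `m` to `m + 1` each cost at most `1 / (m + 1)`,
  -- whence the 2.
  have h3 : w i - c i / ((m : ℝ) + 1) = (w i * m - c i + w i) / (m + 1) := by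
    field_simp
    ring
  rw [h3, abs_of_nonneg (div_nonneg (by linarith [hw i]) hm.le)]
  exact div_le_div_of_nonneg_right (by linarith) hm.le

/-- The ideal measures are dense for the Wasserstein distance. -/
theorem exists_dist_idealPt_lt (μ : PM X) {s : ℕ → X} (hs : DenseRange s) {ε : ℝ} (hε : 0 < ε) :
    ∃ n, dist μ (idealPt s n) < ε := by
  obtain ⟨N, hN⟩ := ((tendsto_integral_dist_nearestPt μ hs).eventually_lt_const
    (half_pos hε)).exists
  let ind := SimpleFunc.nearestPtInd s N
  let w : ℕ → ℝ := fun i => μ.measure.real (ind ⁻¹' {i})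
  have hw : ∑ i ∈ Finset.range (N + 1), w i = 1 := by
    have := (integral_comp_nearestPtInd μ s N fun _ => 1).2
    simpa using this.symm
  -- `K` bounds `∑ |f (s i) - f (s 0)|` for all 1-Lipschitz `f` at once, so `m` does not depend on
  -- `f`.
  set K : ℝ := ∑ i ∈ Finset.range (N + 1), dist (s i) (s 0) with hK
  have hlim : Tendsto (fun m : ℕ => 2 * K * (1 / ((m : ℝ) + 1))) atTop (𝓝 0) := by
    simpa using (tendsto_one_div_add_atTop_nhds_zero_nat (𝕜 := ℝ)).const_mul (2 * K)
  obtain ⟨m, hm⟩ := (hlim.eventually_lt_const (half_pos hε)).exists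
  obtain ⟨n, hn⟩ := exists_listMean_near w (fun _ => measureReal_nonneg) N hw m
  refine ⟨n, lt_of_le_of_lt (dist_le_of_forall (ε := ∫ x, dist x (SimpleFunc.nearestPt s N x)
    ∂μ.measure + 2 * K * (1 / ((m : ℝ) + 1))) fun f hf => ?_) (by linarith)⟩
  obtain ⟨hint, heq⟩ := integral_comp_nearestPtInd μ s N fun i => f (s i)
  rw [integral_idealPt s n hf.continuous]
  have hf' : ∀ x y, |f x - f y| ≤ dist x y := fun x y => by
    simpa [Real.dist_eq] using hf.dist_le_mul x y
  have h1 : |∫ x, f x ∂μ.measure - ∫ x, f (s (ind x)) ∂μ.measure| ≤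
      ∫ x, dist x (SimpleFunc.nearestPt s N x) ∂μ.measure := by
    rw [← integral_sub (μ.integrable_lipschitz hf) hint]
    refine abs_integral_le_integral_abs.trans (integral_mono_of_nonneg
      (.of_forall fun _ => abs_nonneg _) ?_ (.of_forall fun x => hf' _ _))
    exact (μ.moment (s 0)).mono' (aestronglyMeasurable_dist_nearestPt _ s N)
      (.of_forall fun x => norm_dist_nearestPt_le s N x)
  have h2 := hn fun i => f (s i)
  have h3 : ∑ i ∈ Finset.range (N + 1), 2 / ((m : ℝ) + 1) * |f (s i) - f (s 0)| ≤
      2 * K * (1 / ((m : ℝ) + 1)) := by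
    rw [hK, Finset.mul_sum, Finset.sum_mul]
    refine Finset.sum_le_sum fun i _ => ?_
    rw [mul_right_comm, mul_one_div]
    exact mul_le_mul_of_nonneg_left (hf' _ _) (by positivity)
  rw [← heq] at h2
  exact (abs_sub_le _ (∫ x, f (s (ind x)) ∂μ.measure) _).trans (add_le_add h1 (h2.trans h3))

end PM

-- Finite unions of shrunk balls.

section Shrunk

open Filter Topology

variable {X : Type*} [MetricSpace X]

/-- The union of the ideal balls with indices in `l`, with radii decreased by `δ`. -/
def shrunkUnion (s : ℕ → X) (δ : ℝ) (l : List ℕ) : Set X :=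
  {x | ∃ i ∈ l, dist x (s i.unpair.1) + δ < posRat i.unpair.2}

theorem mem_idealBall {s : ℕ → X} {n : ℕ} {x : X} :
    x ∈ idealBall s n ↔ dist x (s n.unpair.1) < posRat n.unpair.2 := Iff.rfl

theorem posRat_pos (n : ℕ) : 0 < posRat n := by
  unfold posRat
  positivity

theorem exists_posRat_lt {ε : ℝ} (hε : 0 < ε) : ∃ n, (posRat n : ℝ) < ε := by
  obtain ⟨n, hn⟩ := exists_nat_one_div_lt hε
  exact ⟨Nat.pair 0 n, by simpa [posRat] using hn⟩

theorem isOpen_shrunkUnion (s : ℕ → X) (δ : ℝ) (l : List ℕ) : IsOpen (shrunkUnion s δ l) := by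
  have : shrunkUnion s δ l =
      ⋃ i ∈ l, {x | dist x (s i.unpair.1) + δ < posRat i.unpair.2} := by
    ext x
    simp [shrunkUnion]
  rw [this]
  exact isOpen_biUnion fun i _ => isOpen_lt (by fun_prop) continuous_const

theorem shrunkUnion_zero (s : ℕ → X) (l : List ℕ) :
    shrunkUnion s 0 l = ⋃ i ∈ l, idealBall s i := by
  ext x
  simp [shrunkUnion, mem_idealBall]

/-- Supplies the separation hypothesis of `PM.measureReal_le_add_dist_div`. -/
theorem le_dist_of_mem_shrunkUnion {s : ℕ → X} {δ η : ℝ} {l : List ℕ} {x y : X}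
    (hx : x ∈ shrunkUnion s (δ + η) l) (hy : y ∉ shrunkUnion s δ l) : η ≤ dist x y := by
  obtain ⟨i, hi, h⟩ := hx
  by_contra! hlt
  refine hy ⟨i, hi, ?_⟩
  have := dist_triangle y x (s i.unpair.1)
  rw [dist_comm y x] at this
  linarith

/-- The finite stages of an enumerated union of ideal balls exhaust its measure. -/
theorem exists_lt_measure_shrunkUnion [MeasurableSpace X] (μ : Measure X) (s : ℕ → X)
    (p : ℕ → Prop) [DecidablePred p] (e : ℕ → ℕ) {a : ℝ≥0∞}
    (ha : a < μ (⋃ i, ⋃ (_ : p i), idealBall s (e i))) :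
    ∀ᶠ M : ℕ in atTop,
      a < μ (shrunkUnion s (2 * ((M : ℝ) + 1)⁻¹) (((List.range M).filter p).map e)) := by
  have hmono : Monotone fun M : ℕ =>
      shrunkUnion s (2 * ((M : ℝ) + 1)⁻¹) (((List.range M).filter p).map e) := by
    rintro M N hMN x ⟨i, hi, hx⟩
    refine ⟨i, ?_, lt_of_le_of_lt ?_ hx⟩
    · simp only [List.mem_map, List.mem_filter, List.mem_range] at hi ⊢
      obtain ⟨j, ⟨hj, hp⟩, rfl⟩ := hi
      exact ⟨j, ⟨hj.trans_le hMN, hp⟩, rfl⟩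
    · gcongr
  have hunion : ⋃ i, ⋃ (_ : p i), idealBall s (e i) = ⋃ M : ℕ,
      shrunkUnion s (2 * ((M : ℝ) + 1)⁻¹) (((List.range M).filter p).map e) := by
    apply Set.Subset.antisymm
    · intro x hx
      simp only [Set.mem_iUnion] at hx ⊢
      obtain ⟨i, hp, hi⟩ := hx
      rw [mem_idealBall] at hi
      obtain ⟨K, hK⟩ := exists_nat_one_div_lt (half_pos (sub_pos.2 hi))
      refine ⟨max K (i + 1), e i, ?_, ?_⟩
      · exact List.mem_map_of_mem (List.mem_filter.2 ⟨List.mem_range.2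
          (lt_of_lt_of_le (Nat.lt_succ_self i) (le_max_right _ _)), by simpa using hp⟩)
      · have : (((max K (i + 1) : ℕ) : ℝ) + 1)⁻¹ ≤ 1 / ((K : ℝ) + 1) := by
          rw [one_div]
          gcongr
          exact le_max_left _ _
        linarith
    · refine Set.iUnion_subset fun M x => ?_
      rintro ⟨i, hi, hx⟩
      simp only [List.mem_map, List.mem_filter, List.mem_range, decide_eq_true_eq] at hi
      obtain ⟨j, ⟨-, hp⟩, rfl⟩ := hi
      refine Set.mem_iUnion₂.2 ⟨j, hp, lt_of_le_of_lt ?_ hx⟩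
      have : (0 : ℝ) ≤ 2 * ((M : ℝ) + 1)⁻¹ := by positivity
      linarith
  rw [hunion] at ha
  exact (tendsto_measure_iUnion_atTop hmono).eventually_const_lt ha

end Shrunk

-- Finite certificates of non-invariance.

section Invariance

open Filter

variable {X : Type*} [MetricSpace X] [MeasurableSpace X] [BorelSpace X]

/-- Outer regularity extends the inequality to all sets, and complements reverse it. Only
subadditivity is applied to preimages, whose measurability is not known. -/
theorem isInvariantMeasure_of_le_isOpen {T : X → X} {μ : PM X}
    (h : ∀ U, IsOpen U → μ.measure (T ⁻¹' U) ≤ μ.measure U) : IsInvariantMeasure T μ := by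
  have hle : ∀ A : Set X, μ.measure (T ⁻¹' A) ≤ μ.measure A := by
    intro A
    rw [A.measure_eq_iInf_isOpen μ.measure]
    exact le_iInf fun U => le_iInf fun hAU => le_iInf fun hU =>
      (measure_mono (Set.preimage_mono hAU)).trans (h U hU)
  intro A hA
  refine le_antisymm (hle A) ?_
  have h1 : μ.measure A + μ.measure Aᶜ ≤ μ.measure (T ⁻¹' A) + μ.measure Aᶜ := by
    calc μ.measure A + μ.measure Aᶜ = μ.measure (T ⁻¹' A ∪ T ⁻¹' Aᶜ) := by
          rw [measure_add_measure_compl hA, ← Set.preimage_union, Set.union_compl_self,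
            Set.preimage_univ]
      _ ≤ μ.measure (T ⁻¹' A) + μ.measure (T ⁻¹' Aᶜ) := measure_union_le _ _
      _ ≤ _ := add_le_add le_rfl (hle _)
  exact (ENNReal.add_le_add_iff_right (measure_ne_top _ _)).1 h1

/-- The finite data by which the `k`-th ideal ball is seen to contain only non-invariant measures:
formally disjoint unions of ideal balls `A`, `G` such that `T⁻¹ A` and `G` have total mass greater
than one, with `T⁻¹ A` approximated by the enumeration `c` of `T`. -/
def RefutesInvariance (s : ℕ → X) (c : Nat.Partrec.Code) (k : ℕ) : Prop :=
  ∃ C G : List ℕ, ∃ M : ℕ, (∀ a ∈ C, a ∈ reSet c) ∧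
    (∀ a ∈ C, ∀ g ∈ G, ((posRat a.unpair.1.unpair.2 + posRat g.unpair.2 : ℚ) : ℝ) <
      dist (s a.unpair.1.unpair.1) (s g.unpair.1)) ∧
    1 + 2 * ((M : ℝ) + 1) * posRat k.unpair.2 <
      (PM.idealPt s k.unpair.1).measure.real
        (shrunkUnion s ((M : ℝ) + 1)⁻¹ (C.map fun a => a.unpair.2)) +
      (PM.idealPt s k.unpair.1).measure.real (shrunkUnion s ((M : ℝ) + 1)⁻¹ G)

variable {s : ℕ → X} {c : Nat.Partrec.Code} {T : X → X} {D : Set X} {μ : PM X}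

/-- For invariant `μ` the disjoint sets `A` and `G` have total mass at most 1. Passing from the
ideal centre to `μ` costs at most `M + 1` radii for each of the two unions, hence the `2 * (M + 1)`
in the certificate. -/
theorem RefutesInvariance.not_isInvariantMeasure {k : ℕ} (h : RefutesInvariance s c k)
    (hT : DescribesMapOn s s c T Dᶜ) (hD : μ.measure D = 0) (hμ : μ ∈ idealBall (PM.idealPt s) k) :
    ¬ IsInvariantMeasure T μ := by
  intro hinv
  obtain ⟨C, G, M, hC, hCG, hmass⟩ := h
  have hM : (0 : ℝ) < (M : ℝ) + 1 := by positivity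
  rw [mem_idealBall, dist_comm] at hμ
  have hnear : ∀ l, (PM.idealPt s k.unpair.1).measure.real (shrunkUnion s ((M : ℝ) + 1)⁻¹ l) ≤
      μ.measure.real (shrunkUnion s 0 l) + ((M : ℝ) + 1) * posRat k.unpair.2 := by
    intro l
    have h1 := (PM.idealPt s k.unpair.1).measureReal_le_add_dist_div μ (inv_pos.2 hM)
      (isOpen_shrunkUnion s 0 l).measurableSet (P := shrunkUnion s ((M : ℝ) + 1)⁻¹ l)
      fun x hx y hy => le_dist_of_mem_shrunkUnion (by rwa [zero_add]) hy
    rw [div_inv_eq_mul] at h1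
    have h2 := mul_le_mul_of_nonneg_right hμ.le hM.le
    linarith
  set A : Set X := ⋃ a ∈ C, idealBall s a.unpair.1 with hA
  have hAm : MeasurableSet A := (isOpen_biUnion fun a _ => Metric.isOpen_ball).measurableSet
  have hpre : μ.measure.real (shrunkUnion s 0 (C.map fun a => a.unpair.2)) ≤ μ.measure.real A := by
    rw [measureReal_def, measureReal_def, ← hinv A hAm]
    refine ENNReal.toReal_mono (measure_ne_top _ _) ?_
    refine (measure_mono (t := T ⁻¹' A ∪ D) fun x hx => ?_).trans
      ((measure_union_le _ _).trans_eq (by rw [hD, add_zero]))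
    by_cases hxD : x ∈ D
    · exact Or.inr hxD
    left
    obtain ⟨i, hi, hx⟩ := hx
    obtain ⟨a, ha, rfl⟩ := List.mem_map.1 hi
    have hmem : x ∈ (⋃ i ∈ {i | Nat.pair a.unpair.1 i ∈ reSet c}, idealBall s i) ∩ Dᶜ := by
      refine ⟨Set.mem_iUnion₂.2 ⟨a.unpair.2, ?_, ?_⟩, hxD⟩
      · change Nat.pair _ _ ∈ reSet c
        rw [Nat.pair_unpair]
        exact hC a ha
      · rw [mem_idealBall]
        linarith
    rw [← hT] at hmem
    exact Set.mem_iUnion₂.2 ⟨a, ha, hmem.1⟩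
  have hdisj : Disjoint A (shrunkUnion s 0 G) := by
    rw [shrunkUnion_zero, Set.disjoint_left]
    intro x hx hx'
    obtain ⟨a, ha, hx⟩ := Set.mem_iUnion₂.1 hx
    obtain ⟨g, hg, hx'⟩ := Set.mem_iUnion₂.1 hx'
    rw [mem_idealBall] at hx hx'
    have h1 := hCG a ha g hg
    push_cast at h1
    linarith [dist_triangle_left (s a.unpair.1.unpair.1) (s g.unpair.1) x]
  have hsum : μ.measure.real A + μ.measure.real (shrunkUnion s 0 G) ≤ 1 := by
    rw [← measureReal_union hdisj (isOpen_shrunkUnion s 0 G).measurableSet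
      (measure_ne_top _ _)]
    exact measureReal_le_one
  linarith [hnear (C.map fun a => a.unpair.2), hnear G]

/-- Take balls of radius below `ε / 4`: target balls with centres deeper than `3 * (ε / 4)` inside
`U`, and balls with centres within `ε / 4` of `Uᶜ`. Such centres are more than `ε / 2` apart, so the
balls are formally disjoint. -/
theorem exists_refutesInvariance (hs : DenseRange s) (hT : DescribesMapOn s s c T Dᶜ)
    (hD : μ.measure D = 0) (hμ : ¬ IsInvariantMeasure T μ) :
    ∃ k, μ ∈ idealBall (PM.idealPt s) k ∧ RefutesInvariance s c k := by
  classical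
  obtain ⟨U, hU, hlt⟩ : ∃ U, IsOpen U ∧ μ.measure U < μ.measure (T ⁻¹' U) := by
    by_contra! h
    exact hμ (isInvariantMeasure_of_le_isOpen h)
  have hUc : Uᶜ.Nonempty := by
    rw [Set.nonempty_compl]
    rintro rfl
    simp at hlt
  obtain ⟨ε, hε, hltε⟩ : ∃ ε : ℝ, 0 < ε ∧
      μ.measure U < μ.measure (T ⁻¹' {x | ε < Metric.infDist x Uᶜ}) := by
    have hmono : Monotone fun M : ℕ => T ⁻¹' {x | 1 / ((M : ℝ) + 1) < Metric.infDist x Uᶜ} := by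
      intro M N hMN x hx
      exact lt_of_le_of_lt (Nat.one_div_le_one_div hMN)
        (show 1 / ((M : ℝ) + 1) < Metric.infDist (T x) Uᶜ from hx)
    have hunion : T ⁻¹' U = ⋃ M : ℕ, T ⁻¹' {x | 1 / ((M : ℝ) + 1) < Metric.infDist x Uᶜ} := by
      rw [← Set.preimage_iUnion]
      congr 1
      ext x
      simp only [Set.mem_iUnion, Set.mem_ofPred_eq]
      constructor
      · intro hx
        refine exists_nat_one_div_lt ?_
        exact (hU.isClosed_compl.notMem_iff_infDist_pos hUc).1 (not_not.2 hx)
      · rintro ⟨M, hM⟩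
        by_contra hx
        rw [Metric.infDist_zero_of_mem (show x ∈ Uᶜ from hx)] at hM
        exact absurd hM (not_lt.2 (by positivity))
    rw [hunion] at hlt
    obtain ⟨M, hM⟩ := ((tendsto_measure_iUnion_atTop hmono).eventually_const_lt hlt).exists
    exact ⟨1 / ((M : ℝ) + 1), by positivity, hM⟩
  obtain ⟨r, hr⟩ := exists_posRat_lt (show 0 < ε / 4 by positivity)
  have hr0 : (0 : ℝ) < posRat r := by exact_mod_cast posRat_pos r
  have hcenter : ∀ x : X, ∃ i, dist x (s i) < posRat r := fun x =>
    hs.exists_dist_lt x hr0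
  -- `a.unpair.1` is a target ball and `a.unpair.2` a source ball mapped into it off `D`.
  let p : ℕ → Prop := fun a => a ∈ reSet c ∧ a.unpair.1.unpair.2 = r ∧
    3 * (ε / 4) < Metric.infDist (s a.unpair.1.unpair.1) Uᶜ
  let p' : ℕ → Prop := fun g => g.unpair.2 = r ∧ Metric.infDist (s g.unpair.1) Uᶜ < ε / 4
  have hlip : ∀ x y : X, Metric.infDist x Uᶜ ≤ Metric.infDist y Uᶜ + dist x y := fun x y =>
    Metric.infDist_le_infDist_add_dist
  have h1 : μ.measure U < μ.measure (⋃ a, ⋃ (_ : p a), idealBall s a.unpair.2) := by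
    refine hltε.trans_le ((measure_mono (t := (⋃ a, ⋃ (_ : p a), idealBall s a.unpair.2) ∪ D)
      fun x hx => ?_).trans ((measure_union_le _ _).trans_eq (by rw [hD, add_zero])))
    by_cases hxD : x ∈ D
    · exact Or.inr hxD
    left
    obtain ⟨i, hi⟩ := hcenter (T x)
    have hmem : x ∈ T ⁻¹' idealBall s (Nat.pair i r) ∩ Dᶜ := ⟨by simpa [mem_idealBall] using hi, hxD⟩
    rw [hT] at hmem
    obtain ⟨j, hj, hxj⟩ := Set.mem_iUnion₂.1 hmem.1
    refine Set.mem_iUnion₂.2 ⟨Nat.pair (Nat.pair i r) j, ⟨hj, by simp, ?_⟩, by simpa using hxj⟩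
    have hx : ε < Metric.infDist (T x) Uᶜ := hx
    simp only [Nat.unpair_pair]
    linarith [hlip (T x) (s i)]
  have h2 : μ.measure Uᶜ ≤ μ.measure (⋃ g, ⋃ (_ : p' g), idealBall s g) := by
    refine measure_mono fun x hx => ?_
    obtain ⟨i, hi⟩ := hcenter x
    refine Set.mem_iUnion₂.2 ⟨Nat.pair i r, ⟨by simp, ?_⟩, by simpa [mem_idealBall] using hi⟩
    have h3 := hlip (s i) x
    rw [Metric.infDist_zero_of_mem hx, dist_comm] at h3
    simp only [Nat.unpair_pair]
    linarith
  -- Of the shrinking `2 / (M + 1)`, half is spent in passing to an ideal measure; the other half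
  -- stays in the certificate.
  obtain ⟨η, hη, M, hM⟩ : ∃ η : ℝ, 0 < η ∧ ∃ M : ℕ, 1 + η <
      μ.measure.real (shrunkUnion s (2 * ((M : ℝ) + 1)⁻¹)
        (((List.range M).filter p).map fun a => a.unpair.2)) +
      μ.measure.real (shrunkUnion s (2 * ((M : ℝ) + 1)⁻¹)
        (((List.range M).filter p').map id)) := by
    have h3 : μ.measure.real U < μ.measure.real (⋃ a, ⋃ (_ : p a), idealBall s a.unpair.2) :=
      (ENNReal.toReal_lt_toReal (measure_ne_top _ _) (measure_ne_top _ _)).2 h1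
    have h4 : 1 - μ.measure.real U ≤ μ.measure.real (⋃ g, ⋃ (_ : p' g), idealBall s (id g)) := by
      rw [← probReal_compl_eq_one_sub hU.measurableSet]
      exact ENNReal.toReal_mono (measure_ne_top _ _) h2
    -- Each of the two finite unions may lose a third of the excess; the last third is the margin.
    set η := (μ.measure.real (⋃ a, ⋃ (_ : p a), idealBall s a.unpair.2) - μ.measure.real U) / 3
      with hη
    have hη0 : 0 < η := by
      rw [hη]
      linarith
    have key : ∀ (q : ℕ → Prop) [DecidablePred q] (e : ℕ → ℕ), ∀ᶠ M : ℕ in atTop,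
        μ.measure.real (⋃ i, ⋃ (_ : q i), idealBall s (e i)) - η <
          μ.measure.real (shrunkUnion s (2 * ((M : ℝ) + 1)⁻¹) (((List.range M).filter q).map e)) := by
      intro q _ e
      rcases lt_or_ge (μ.measure.real (⋃ i, ⋃ (_ : q i), idealBall s (e i)) - η) 0 with h0 | h0
      · exact .of_forall fun M => h0.trans_le measureReal_nonneg
      · refine (exists_lt_measure_shrunkUnion μ.measure s q e (a := ENNReal.ofReal
          (μ.measure.real (⋃ i, ⋃ (_ : q i), idealBall s (e i)) - η)) ?_).mono fun M hM => ?_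
        · rw [ENNReal.ofReal_lt_iff_lt_toReal h0 (measure_ne_top _ _)]
          exact sub_lt_self _ hη0
        · exact (ENNReal.ofReal_lt_iff_lt_toReal h0 (measure_ne_top _ _)).1 hM
    obtain ⟨M, hM1, hM2⟩ := ((key p fun a => a.unpair.2).and (key p' id)).exists
    exact ⟨η, hη0, M, by linarith⟩
  rw [List.map_id] at hM
  have hM0 : (0 : ℝ) < (M : ℝ) + 1 := by positivity
  -- The 4 is 2 for the certificate and 1 for each of the two transfers of mass.
  obtain ⟨t, ht⟩ := exists_posRat_lt (show 0 < η / (4 * ((M : ℝ) + 1)) by positivity)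
  rw [lt_div_iff₀ (by positivity)] at ht
  obtain ⟨n, hn⟩ := PM.exists_dist_idealPt_lt μ hs
    (show (0 : ℝ) < posRat t by exact_mod_cast posRat_pos t)
  refine ⟨Nat.pair n t, by simpa [mem_idealBall] using hn, (List.range M).filter p,
    (List.range M).filter p', M, fun a ha => ?_, fun a ha g hg => ?_, ?_⟩
  · have hpa : p a := by simpa using (List.mem_filter.1 ha).2
    exact hpa.1
  · obtain ⟨-, ha1, ha2⟩ : p a := by simpa using (List.mem_filter.1 ha).2
    obtain ⟨hg1, hg2⟩ : p' g := by simpa using (List.mem_filter.1 hg).2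
    rw [ha1, hg1]
    push_cast
    linarith [hlip (s a.unpair.1.unpair.1) (s g.unpair.1)]
  · have hnear : ∀ l, μ.measure.real (shrunkUnion s (2 * ((M : ℝ) + 1)⁻¹) l) ≤
        (PM.idealPt s n).measure.real (shrunkUnion s ((M : ℝ) + 1)⁻¹ l) +
          posRat t * ((M : ℝ) + 1) := by
      intro l
      have h5 := μ.measureReal_le_add_dist_div (PM.idealPt s n) (inv_pos.2 hM0)
        (isOpen_shrunkUnion s ((M : ℝ) + 1)⁻¹ l).measurableSet
        (P := shrunkUnion s (2 * ((M : ℝ) + 1)⁻¹) l)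
        fun x hx y hy => le_dist_of_mem_shrunkUnion (by rwa [← two_mul]) hy
      rw [div_inv_eq_mul] at h5
      have h6 := mul_le_mul_of_nonneg_right hn.le hM0.le
      linarith
    have h7 := hnear (((List.range M).filter p).map fun a => a.unpair.2)
    have h8 := hnear ((List.range M).filter p')
    simp only [Nat.unpair_pair]
    linarith

end Invariance

-- Enumerability of distance bounds and certificates.

section Enumeration

variable {X α : Type*} [MetricSpace X] [Primcodable α]

open Computable

theorem primrec_atoms : Primrec PM.atoms :=
  Primrec.list_cons.comp (Primrec.fst.comp Primrec.unpair)
    ((Primrec.ofNat (List ℕ)).comp (Primrec.snd.comp Primrec.unpair))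

theorem primrec_sum_map_getD :
    Primrec fun x : List ℕ × List ℕ => (x.2.map fun i => x.1.getD i 0).sum := by
  have h : Primrec fun x : List ℕ × List ℕ => x.2.map fun i => x.1.getD i 0 :=
    Primrec.list_map Primrec.snd ((Primrec.list_getD 0).comp₂
      (Primrec₂.mk (Primrec.fst.comp Primrec.fst)) Primrec₂.right)
  have h' : Primrec₂ fun (_ : List ℕ × List ℕ) (y : ℕ × ℕ) => y.1 + y.2 :=
    Primrec₂.mk (Primrec.nat_add.comp (Primrec.fst.comp Primrec.snd)
      (Primrec.snd.comp Primrec.snd))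
  exact (Primrec.list_foldr h (Primrec.const 0) h').of_eq fun _ => rfl

/-- The mean along the atoms of an ideal measure, as a rational number. -/
theorem exists_computableRat_listMean {v : α → List ℕ} {k : α → ℕ} (hv : Computable v)
    (hk : Computable k) : ∃ m : α → ℚ, ComputableRat m ∧
      ∀ a, (m a : ℝ) = listMean (PM.atoms (k a)) fun i => (v a).getD i 0 := by
  -- The number of atoms is written `tail.length + 1` to fit `ComputableRat.inv_succ`.
  refine ⟨fun a => (((PM.atoms (k a)).map fun i => (v a).getD i 0).sum : ℕ) *
      (((PM.atoms (k a)).tail.length : ℚ) + 1)⁻¹, ?_, fun a => ?_⟩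
  · have h := primrec_atoms.to_comp.comp hk
    exact (ComputableRat.natCast (primrec_sum_map_getD.to_comp.comp (hv.pair h))).mul
      (ComputableRat.inv_succ ((Primrec.list_length.comp Primrec.list_tail).to_comp.comp h))
  · rw [listMean, div_eq_mul_inv]
    push_cast
    simp [PM.atoms, Function.comp_def]

-- Membership of an atom is a strict upper bound on a computable distance, hence r.e.; so lower
-- bounds on the count are enumerable.
open Classical in
theorem ComputableMetricSpace.rePred_le_countP_shrunkUnion (S : ComputableMetricSpace X)
    {k M u : α → ℕ} {l : α → List ℕ} (hk : Computable k) (hM : Computable M)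
    (hu : Computable u) (hl : Computable l) :
    REPred fun a => u a ≤
      (PM.atoms (k a)).countP (S.pt · ∈ shrunkUnion S.pt ((M a : ℝ) + 1)⁻¹ (l a)) := by
  refine REPred.le_countP ?_ (primrec_atoms.to_comp.comp hk) hu
  have h : REPred fun x : (α × ℕ) × ℕ => dist (S.pt x.1.2) (S.pt x.2.unpair.1) <
      ((posRat x.2.unpair.2 - ((M x.1.1 : ℚ) + 1)⁻¹ : ℚ) : ℝ) :=
    S.rePred_dist_lt ((ComputableRat.posRat_comp snd.unpair_snd).sub
      (ComputableRat.inv_succ (hM.comp (fst.comp fst)))) (snd.comp fst) snd.unpair_fst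
  refine (h.exists_mem (hl.comp fst)).of_eq fun x => ?_
  simp only [shrunkUnion, Set.mem_ofPred_eq]
  refine exists_congr fun i => and_congr Iff.rfl ?_
  push_cast
  exact lt_sub_iff_add_lt

theorem Computable.getD_zero {v : α → List ℕ} {i : α → ℕ} (hv : Computable v)
    (hi : Computable i) : Computable fun a => (v a).getD (i a) 0 :=
  (Primrec.list_getD 0).to_comp.comp hv hi

theorem ComputableMetricSpace.rePred_forall_sub_lt_dist (S : ComputableMetricSpace X)
    {l v : α → List ℕ} {N : α → ℕ} (hl : Computable l) (hv : Computable v) (hN : Computable N) :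
    REPred fun a => ∀ i ∈ l a, ∀ j ∈ l a,
      ((((((v a).getD i 0 : ℕ) : ℚ) - ((v a).getD j 0 : ℕ) - 1) * ((N a : ℚ) + 1)⁻¹ : ℚ) : ℝ) <
        dist (S.pt i) (S.pt j) := by
  have ha : Computable fun x : (α × ℕ) × ℕ => x.1.1 := fst.comp fst
  have hi : Computable fun x : (α × ℕ) × ℕ => x.1.2 := snd.comp fst
  have hj : Computable fun x : (α × ℕ) × ℕ => x.2 := snd
  have h := S.rePred_lt_dist ((((ComputableRat.natCast ((hv.comp ha).getD_zero hi)).sub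
    (ComputableRat.natCast ((hv.comp ha).getD_zero hj))).sub ComputableRat.one).mul
      (ComputableRat.inv_succ (hN.comp ha))) hi hj
  exact (h.forall_mem (hl.comp fst)).forall_mem hl

theorem ComputableMetricSpace.rePred_forall_add_lt_dist (S : ComputableMetricSpace X)
    {C G : α → List ℕ} (hC : Computable C) (hG : Computable G) :
    REPred fun x => ∀ a ∈ C x, ∀ g ∈ G x,
      ((posRat a.unpair.1.unpair.2 + posRat g.unpair.2 : ℚ) : ℝ) <
        dist (S.pt a.unpair.1.unpair.1) (S.pt g.unpair.1) := by
  have ha : Computable fun x : (α × ℕ) × ℕ => x.1.2 := snd.comp fst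
  have hg : Computable fun x : (α × ℕ) × ℕ => x.2 := snd
  have h := S.rePred_lt_dist ((ComputableRat.posRat_comp ha.unpair_fst.unpair_snd).add
    (ComputableRat.posRat_comp hg.unpair_snd)) ha.unpair_fst.unpair_fst hg.unpair_fst
  exact (h.forall_mem (hG.comp fst)).forall_mem hC

variable [MeasurableSpace X] [BorelSpace X] (S : ComputableMetricSpace X)

/-- The Wasserstein distance between ideal measures is lower semicomputable. -/
theorem ComputableMetricSpace.rePred_lt_dist_idealPt {f : α → ℚ} {k n : α → ℕ}
    (hf : ComputableRat f) (hk : Computable k) (hn : Computable n) :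
    REPred fun a => (f a : ℝ) < dist (PM.idealPt S.pt (k a)) (PM.idealPt S.pt (n a)) := by
  let β := (α × List ℕ) × ℕ
  have ha : Computable fun x : β => x.1.1 := fst.comp fst
  have hv : Computable fun x : β => x.1.2 := snd.comp fst
  have hN : Computable fun x : β => x.2 := snd
  have hl : Computable fun x : β => PM.atoms (k x.1.1) ++ PM.atoms (n x.1.1) :=
    Primrec.list_append.to_comp.comp (primrec_atoms.to_comp.comp (hk.comp ha))
      (primrec_atoms.to_comp.comp (hn.comp ha))
  have hlip := S.rePred_forall_sub_lt_dist hl hv hN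
  obtain ⟨m₁, hm₁, he₁⟩ := exists_computableRat_listMean hv (hk.comp ha)
  obtain ⟨m₂, hm₂, he₂⟩ := exists_computableRat_listMean hv (hn.comp ha)
  have hf' : ComputableRat fun x : β => f x.1.1 := by
    obtain ⟨u, v, w, hu, hv, hw, h⟩ := hf
    exact ⟨_, _, _, hu.comp ha, hv.comp ha, hw.comp ha, fun x => h _⟩
  have hgap : REPred fun x : β => f x.1.1 * ((x.2 : ℚ) + 1) + 1 < m₁ x - m₂ x :=
    ((((hf'.mul ((ComputableRat.natCast hN).add .one)).add .one).lt (hm₁.sub hm₂)).to_re)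
  refine (hlip.and hgap).exists_snd.exists_snd.of_eq fun a => ?_
  rw [PM.lt_dist_idealPt_iff]
  refine exists_congr fun v => exists_congr fun N => and_congr ?_ ?_
  · push_cast
    rfl
  · rw [← he₁ ((a, v), N), ← he₂ ((a, v), N), ← Rat.cast_lt (K := ℝ)]
    push_cast
    rfl

/-- The atom counts are only semicomputable from below, so the search also guesses lower bounds `u`,
`w` for them, compared by rational arithmetic. -/
theorem ComputableMetricSpace.rePred_refutesInvariance {c : α → Nat.Partrec.Code} {k : α → ℕ}
    (hc : Computable c) (hk : Computable k) :
    REPred fun a => RefutesInvariance S.pt (c a) (k a) := by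
  classical
  let β := (((α × List ℕ) × List ℕ) × ℕ) × ℕ × ℕ
  have ha : Computable fun x : β => x.1.1.1.1 := fst.comp (fst.comp (fst.comp fst))
  have hC : Computable fun x : β => x.1.1.1.2 := snd.comp (fst.comp (fst.comp fst))
  have hG : Computable fun x : β => x.1.1.2 := snd.comp (fst.comp fst)
  have hM : Computable fun x : β => x.1.2 := snd.comp fst
  have hu : Computable fun x : β => x.2.1 := fst.comp snd
  have hw : Computable fun x : β => x.2.2 := snd.comp snd
  have hatom : Computable fun x : β => (k x.1.1.1.1).unpair.1 := (hk.comp ha).unpair_fst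
  have h1 : REPred fun x : β => ∀ a ∈ x.1.1.1.2, a ∈ reSet (c x.1.1.1.1) :=
    REPred.forall_mem (rePred_mem_reSet.comp_computable ((hc.comp (ha.comp fst)).pair snd)) hC
  have h2 := S.rePred_forall_add_lt_dist hC hG
  have hmap : Computable fun x : β => x.1.1.1.2.map fun a => a.unpair.2 := by
    have : Primrec fun l : List ℕ => l.map fun a => a.unpair.2 :=
      Primrec.list_map Primrec.id (Primrec₂.mk (Primrec.snd.comp (Primrec.unpair.comp Primrec.snd)))
    exact this.to_comp.comp hC
  have h3 := S.rePred_le_countP_shrunkUnion hatom hM hu hmap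
  have h4 := S.rePred_le_countP_shrunkUnion hatom hM hw hG
  have hlen : ComputableRat fun x : β =>
      (((PM.atoms (k x.1.1.1.1).unpair.1).tail.length : ℚ) + 1)⁻¹ :=
    ComputableRat.inv_succ ((Primrec.list_length.comp Primrec.list_tail).to_comp.comp
      (primrec_atoms.to_comp.comp hatom))
  have h5 : REPred fun x : β => 1 + ((2 : ℕ) : ℚ) * ((x.1.2 : ℚ) + 1) *
      posRat (k x.1.1.1.1).unpair.2 <
        ((x.2.1 : ℚ) + x.2.2) * (((PM.atoms (k x.1.1.1.1).unpair.1).tail.length : ℚ) + 1)⁻¹ :=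
    (ComputableRat.lt (ComputableRat.one.add (((ComputableRat.natCast (.const 2)).mul
      ((ComputableRat.natCast hM).add .one)).mul
        (ComputableRat.posRat_comp (hk.comp ha).unpair_snd)))
      (((ComputableRat.natCast hu).add (ComputableRat.natCast hw)).mul hlen)).to_re
  refine (h1.and (h2.and (h3.and (h4.and h5)))).exists_snd.exists_snd.exists_snd.exists_snd.of_eq
    fun a => ?_
  refine exists_congr fun C => exists_congr fun G => exists_congr fun M => ?_
  have hlen' : ∀ n, ((PM.atoms n).length : ℝ) = ((PM.atoms n).tail.length : ℝ) + 1 := fun n => by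
    simp [PM.atoms]
  rw [PM.measureReal_idealPt _ _ (isOpen_shrunkUnion _ _ _).measurableSet,
    PM.measureReal_idealPt _ _ (isOpen_shrunkUnion _ _ _).measurableSet, ← add_div,
    div_eq_mul_inv, hlen']
  constructor
  · rintro ⟨⟨u, w⟩, h1, h2, h3, h4, h5⟩
    refine ⟨h1, h2, ?_⟩
    rw [← Rat.cast_lt (K := ℝ)] at h5
    push_cast at h5
    refine h5.trans_le ?_
    gcongr
  · rintro ⟨h1, h2, h5⟩
    refine ⟨((PM.atoms (k a).unpair.1).countP (S.pt · ∈ shrunkUnion S.pt ((M : ℝ) + 1)⁻¹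
      (C.map fun a => a.unpair.2)), (PM.atoms (k a).unpair.1).countP
        (S.pt · ∈ shrunkUnion S.pt ((M : ℝ) + 1)⁻¹ G)), h1, h2, le_rfl, le_rfl, ?_⟩
    rw [← Rat.cast_lt (K := ℝ)]
    push_cast
    exact h5

end Enumeration

-- Finite covers and the algorithm.

section Main

variable {X : Type*} [MetricSpace X] [MeasurableSpace X] [BorelSpace X]

/-- A point outside a closed ball around an ideal measure lies in an ideal ball that is formally
exterior to it. -/
theorem exists_mem_idealBall_exterior {s : ℕ → X} (hs : DenseRange s) {n : ℕ} {ν : PM X}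
    (hν : ν ∉ idealClosedBall (PM.idealPt s) n) : ∃ k, ν ∈ idealBall (PM.idealPt s) k ∧
      ((posRat k.unpair.2 + posRat n.unpair.2 : ℚ) : ℝ) <
        dist (PM.idealPt s k.unpair.1) (PM.idealPt s n.unpair.1) := by
  rw [idealClosedBall, Metric.mem_closedBall, not_le] at hν
  obtain ⟨t, ht⟩ := exists_posRat_lt (half_pos (sub_pos.2 hν))
  obtain ⟨i, hi⟩ := PM.exists_dist_idealPt_lt ν hs
    (show (0 : ℝ) < posRat t by exact_mod_cast posRat_pos t)
  refine ⟨Nat.pair i t, by simpa [mem_idealBall] using hi, ?_⟩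
  simp only [Nat.unpair_pair]
  push_cast
  have := dist_triangle ν (PM.idealPt s i) (PM.idealPt s n.unpair.1)
  linarith

theorem notMem_idealBall_of_exterior {s : ℕ → X} {k n : ℕ} {ν : PM X}
    (h : ((posRat k.unpair.2 + posRat n.unpair.2 : ℚ) : ℝ) <
      dist (PM.idealPt s k.unpair.1) (PM.idealPt s n.unpair.1))
    (hν : ν ∈ idealBall (PM.idealPt s) n) : ν ∉ idealBall (PM.idealPt s) k := by
  intro hk
  rw [mem_idealBall] at hν hk
  push_cast at h
  linarith [dist_triangle_left (PM.idealPt s k.unpair.1) (PM.idealPt s n.unpair.1) ν]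

/-- The `k`-th ideal ball is the `m`-th one, or it is formally exterior to the `n`-th one, or it is
seen to contain only non-invariant measures. -/
def IsRemovableBall (s : ℕ → X) (c : Nat.Partrec.Code) (n m k : ℕ) : Prop :=
  k = m ∨ ((posRat k.unpair.2 + posRat n.unpair.2 : ℚ) : ℝ) <
    dist (PM.idealPt s k.unpair.1) (PM.idealPt s n.unpair.1) ∨ RefutesInvariance s c k

theorem ComputableMetricSpace.rePred_isRemovableBall {α : Type*} [Primcodable α]
    (S : ComputableMetricSpace X) {c : α → Nat.Partrec.Code} {n m k : α → ℕ} (hc : Computable c)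
    (hn : Computable n) (hm : Computable m) (hk : Computable k) :
    REPred fun a => IsRemovableBall S.pt (c a) (n a) (m a) (k a) :=
  (Primrec.eq.computablePred.comp_computable (hk.pair hm)).to_re.or
    ((S.rePred_lt_dist_idealPt ((ComputableRat.posRat_comp hk.unpair_snd).add
      (ComputableRat.posRat_comp hn.unpair_snd)) hk.unpair_fst hn.unpair_fst).or
    (S.rePred_refutesInvariance hc hk))

/-- The compact set described by `cV` is covered by the `m`-th ideal ball together with finitely many
balls that cannot contain the invariant measure isolated by the `n`-th ball. -/
def HasCover (s : ℕ → X) (cT cV : Nat.Partrec.Code) (n m : ℕ) : Prop :=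
  ∃ l : List ℕ, Encodable.encode l ∈ reSet cV ∧ ∀ k ∈ l, IsRemovableBall s cT n m k

/-- The ideal balls containing an isolated invariant measure are characterized by the existence of
a finite cover of the compact set. -/
theorem mem_idealBall_iff_hasCover {s : ℕ → X} (hs : DenseRange s) {D : Set X} {T : X → X}
    {V : Set (PM X)} {cT cV : Nat.Partrec.Code} {n : ℕ} {μ : PM X}
    (hT : DescribesMapOn s s cT T Dᶜ) (hV : DescribesCompact (PM.idealPt s) cV V)
    (hD : ∀ ν ∈ V, ν.measure D = 0) (hμ : IsolatingBall s T V n μ) (m : ℕ) :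
    μ ∈ idealBall (PM.idealPt s) m ↔ HasCover s cT cV n m := by
  obtain ⟨hμn, hiso⟩ := hμ
  have hμmem : μ ∈ idealClosedBall (PM.idealPt s) n ∩ {ν | ν ∈ V ∧ IsInvariantMeasure T ν} := by
    rw [hiso]
    rfl
  obtain ⟨-, hμV, hμT⟩ := hμmem
  constructor
  · intro hm
    have hcover : V ⊆ ⋃ k : {k // IsRemovableBall s cT n m k}, idealBall (PM.idealPt s) k := by
      intro ν hν
      rw [Set.mem_iUnion]
      by_cases h1 : ν ∈ idealClosedBall (PM.idealPt s) n
      · by_cases h2 : IsInvariantMeasure T ν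
        · have h3 : ν ∈ ({μ} : Set (PM X)) := hiso ▸ ⟨h1, hν, h2⟩
          rw [Set.mem_singleton_iff] at h3
          exact ⟨⟨m, Or.inl rfl⟩, h3 ▸ hm⟩
        · obtain ⟨k, hk, hr⟩ := exists_refutesInvariance hs hT (hD ν hν) h2
          exact ⟨⟨k, Or.inr (Or.inr hr)⟩, hk⟩
      · obtain ⟨k, hk, hr⟩ := exists_mem_idealBall_exterior hs h1
        exact ⟨⟨k, Or.inr (Or.inl hr)⟩, hk⟩
    obtain ⟨t, ht⟩ := hV.1.elim_finite_subcover _ (fun _ => Metric.isOpen_ball) hcover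
    refine ⟨t.toList.map Subtype.val, (hV.2 _).2 (ht.trans ?_), fun k hk => ?_⟩
    · refine Set.iUnion₂_subset fun k hk => ?_
      exact Set.subset_biUnion_of_mem (u := fun i => idealBall (PM.idealPt s) i)
        (List.mem_map_of_mem (Finset.mem_toList.2 hk))
    · obtain ⟨k, -, rfl⟩ := List.mem_map.1 hk
      exact k.2
  · rintro ⟨l, hl, hlm⟩
    obtain ⟨k, hk, hμk⟩ := Set.mem_iUnion₂.1 ((hV.2 l).1 hl hμV)
    rcases hlm k hk with rfl | h | h
    · exact hμk
    · exact absurd hμk (notMem_idealBall_of_exterior h hμn)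
    · exact absurd hμT (h.not_isInvariantMeasure hT (hD μ hμV) hμk)

theorem ComputableMetricSpace.rePred_hasCover {α : Type*} [Primcodable α]
    (S : ComputableMetricSpace X) {cT cV : α → Nat.Partrec.Code} {n m : α → ℕ}
    (hT : Computable cT) (hV : Computable cV) (hn : Computable n) (hm : Computable m) :
    REPred fun a => HasCover S.pt (cT a) (cV a) (n a) (m a) := by
  have h1 := rePred_mem_reSet.comp_computable ((hV.comp (Computable.fst (β := List ℕ))).pair
    (Computable.encode.comp Computable.snd))
  have h (c : (α × List ℕ) × ℕ → α) (hc : Computable c) := S.rePred_isRemovableBall (hT.comp hc)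
    (hn.comp hc) (hm.comp hc) (Computable.snd (α := α × List ℕ) (β := ℕ))
  have h2 := (h _ (Computable.fst.comp Computable.fst)).forall_mem Computable.snd
  exact (h1.and h2).exists_snd

/-- `HasCover` is r.e. jointly in the data and `m`, so currying produces the program; `Φ` is total,
and the hypotheses enter only in its correctness. -/
theorem exists_computable_describesPoint (S : ComputableMetricSpace X) :
    ∃ Φ : Nat.Partrec.Code × Nat.Partrec.Code × ℕ → Nat.Partrec.Code, Computable Φ ∧
      ∀ (D : Set X) (T : X → X) (V : Set (PM X)) (cT cV : Nat.Partrec.Code) (n : ℕ) (μ : PM X),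
        DescribesMapOn S.pt S.pt cT T Dᶜ →
        DescribesCompact (PM.idealPt S.pt) cV V →
        (∀ ν ∈ V, ν.measure D = 0) →
        IsolatingBall S.pt T V n μ →
        DescribesPoint (PM.idealPt S.pt) (Φ (cT, cV, n)) μ := by
  obtain ⟨Φ, hΦ, hΦm⟩ := REPred.exists_computable_code
    (α := Nat.Partrec.Code × Nat.Partrec.Code × ℕ) (p := fun a m => HasCover S.pt a.1 a.2.1 a.2.2 m)
    (S.rePred_hasCover (Computable.fst.comp Computable.fst)
      (Computable.fst.comp (Computable.snd.comp Computable.fst))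
      (Computable.snd.comp (Computable.snd.comp Computable.fst)) Computable.snd)
  refine ⟨Φ, hΦ, fun D T V cT cV n μ hT hV hD hμ => ?_⟩
  rw [DescribesPoint, hΦm]
  ext m
  exact (mem_idealBall_iff_hasCover S.dense hT hV hD hμ m).symm

/-- A radius below `ε / 2` keeps even the closed ball inside the `ε`-ball around `μ`. -/
theorem IsIsolatedInvariant.exists_isolatingBall {s : ℕ → X} (hs : DenseRange s) {T : X → X}
    {V : Set (PM X)} {μ : PM X} (h : IsIsolatedInvariant T V μ) :
    ∃ n, IsolatingBall s T V n μ := by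
  obtain ⟨U, hU, hiso⟩ := h
  have hμ : μ ∈ U ∩ {ν | ν ∈ V ∧ IsInvariantMeasure T ν} := by
    rw [hiso]
    rfl
  obtain ⟨ε, hε, hball⟩ := Metric.isOpen_iff.1 hU μ hμ.1
  obtain ⟨t, ht⟩ := exists_posRat_lt (half_pos hε)
  obtain ⟨i, hi⟩ := PM.exists_dist_idealPt_lt μ hs
    (show (0 : ℝ) < posRat t by exact_mod_cast posRat_pos t)
  have hmem : μ ∈ idealBall (PM.idealPt s) (Nat.pair i t) := by simpa [mem_idealBall] using hi
  refine ⟨Nat.pair i t, hmem, Set.Subset.antisymm (fun ν hν => ?_) ?_⟩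
  · rw [← hiso]
    refine ⟨hball ?_, hν.2⟩
    have h1 : dist ν (PM.idealPt s i) ≤ posRat t := by
      simpa [idealClosedBall] using hν.1
    rw [Metric.mem_ball]
    linarith [dist_triangle_right ν μ (PM.idealPt s i)]
  · rintro _ rfl
    exact ⟨Metric.ball_subset_closedBall hmem, hμ.2⟩

end Main

theorem theorem4p2 {X : Type*} [MetricSpace X] [MeasurableSpace X] [BorelSpace X]
    (S : ComputableMetricSpace X) :
    (∀ (D : Set X) (T : X → X) (V : Set (PM X)),
      IsComputableOn S.pt S.pt T Dᶜ →
      IsRecursivelyCompact (PM.idealPt S.pt) V →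
      (∀ μ ∈ V, μ.measure D = 0) →
      ∀ μ : PM X, IsIsolatedInvariant T V μ → IsComputablePoint (PM.idealPt S.pt) μ) ∧
    (∃ Φ : Nat.Partrec.Code × Nat.Partrec.Code × ℕ → Nat.Partrec.Code, Computable Φ ∧
      ∀ (D : Set X) (T : X → X) (V : Set (PM X)) (cT cV : Nat.Partrec.Code) (n : ℕ) (μ : PM X),
        DescribesMapOn S.pt S.pt cT T Dᶜ →
        DescribesCompact (PM.idealPt S.pt) cV V →
        (∀ ν ∈ V, ν.measure D = 0) →
        IsolatingBall S.pt T V n μ →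
        DescribesPoint (PM.idealPt S.pt) (Φ (cT, cV, n)) μ) := by
  obtain ⟨Φ, hΦ, h⟩ := exists_computable_describesPoint S
  refine ⟨fun D T V ⟨cT, hT⟩ ⟨cV, hV⟩ hD μ hμ => ?_, Φ, hΦ, h⟩
  obtain ⟨n, hn⟩ := hμ.exists_isolatingBall S.dense
  exact ⟨_, h D T V cT cV n μ hT hV hD hn⟩
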